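/- Let $\sigma,T,L>0$, put $\overline Q=[0,L]$ and $\overline Q_T=[0,T]\times[0,L]$, let $m_0$ be a Borel probability measure on $\overline Q$ and let $b:\overline Q_T\to\mathbb R$ be a function. Consider the Fokker–Planck problem $$m_t-\tfrac{\sigma^2}{2}m_{xx}-(bm)_x=0\ \text{ in }(0,T)\times(0,L),\qquad m(0)=m_0,$$ $$m(t,0)=0,\qquad \tfrac{\sigma^2}{2}m_x(t,L)+b(t,L)m(t,L)=0\quad\text{for }t\in(0,T).$$ A *measure-valued weak solution* of this problem is a measure $\mathbf m$ on $\overline Q_T$ of the form $d\mathbf m=dm(t)\,dt$, where $m(t)$ is, for every $t\in[0,T]$, a positive Borel measure on $\overline Q$ with $m(t,\overline Q)\le 1$, and $t\mapsto m(t,A)$ is measurable on $[0,T]$ for every Borel set $A\subset\overline Q$, such that $b\in L^2_{\mathbf m}$, that is, $b$ is $\mathbf m$-measurable and $\int_{\overline Q_T}|b|^2\,d\mathbf m<\infty$, and $$\int_{\overline Q_T}\Big(-\phi_t-\tfrac{\sigma^2}{2}\phi_{xx}+b\,\phi_x\Big)\,d\mathbf m=\int_{\overline Q}\phi(0,\cdot)\,dm_0$$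 for every test function $\phi\in C_c^\infty([0,T)\times\overline Q)$ (the restriction to $[0,T)\times\overline Q$ of a smooth function on $\mathbb R^2$, with support a compact subset of $[0,T)\times\overline Q$) that satisfies $\phi(t,0)=\phi_x(t,L)=0$ for all $t\in(0,T)$. Then there is at most one measure-valued weak solution: if $\mathbf m_1$ and $\mathbf m_2$ are measure-valued weak solutions for the same $b$ and $m_0$, then $\mathbf m_1=\mathbf m_2$ as measures on $\overline Q_T$. -/

import Mathlib

open MeasureTheory ProbabilityTheory Set
open scoped ContDiff

namespace FokkerPlanck

/-- Test functions: `φ ∈ C_c^∞([0,T) × [0,L])` with `φ(t,0) = 0` and `φ_x(t,L) = 0` for all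
`t ∈ (0,T)`. Smoothness up to the boundary means being the restriction of a smooth function on the
plane, and `φ` is such an extension; all the other conditions see only its values on
`[0,T) × [0,L]`, and the support in `[0,T) × [0,L]` is a compact subset of `[0,T) × [0,L]`. -/
structure IsTestFunction (T L : ℝ) (φ : ℝ → ℝ → ℝ) : Prop where
  smooth : ContDiff ℝ ∞ (Function.uncurry φ)
  compact_support : ∃ K : Set (ℝ × ℝ), IsCompact K ∧ K ⊆ Ico 0 T ×ˢ Icc 0 L ∧
    ∀ p ∈ Ico 0 T ×ˢ Icc 0 L, p ∉ K → φ p.1 p.2 = 0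
  dirichlet : ∀ t ∈ Ioo 0 T, φ t 0 = 0
  neumann : ∀ t ∈ Ioo 0 T, deriv (fun y => φ t y) L = 0

/-- The value at `(t,x)` of the dual operator `-φ_t - (σ²/2) φ_xx + β φ_x`, where `β` is the value
of the drift at `(t,x)`. -/
noncomputable def dualOperator (σ β : ℝ) (φ : ℝ → ℝ → ℝ) (t x : ℝ) : ℝ :=
  -deriv (fun s => φ s x) t - σ ^ 2 / 2 * iteratedDeriv 2 (fun y => φ t y) x
    + β * deriv (fun y => φ t y) x

/-- Lebesgue measure `dt` on `[0,T]`. -/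
noncomputable def timeMeasure (T : ℝ) : Measure (Icc (0 : ℝ) T) :=
  Measure.comap Subtype.val volume

/-- Measure-valued weak solutions `M`, a measure on `[0,T] × [0,L]`, of
`m_t - (σ²/2) m_xx - (b m)_x = 0`, `m(0) = m₀`, with `m(t,0) = 0` and
`(σ²/2) m_x(t,L) + b(t,L) m(t,L) = 0`. -/
structure IsMeasureValuedWeakSolution (σ T L : ℝ) (b : Icc (0 : ℝ) T × Icc (0 : ℝ) L → ℝ)
    (m₀ : Measure (Icc (0 : ℝ) L)) (M : Measure (Icc (0 : ℝ) T × Icc (0 : ℝ) L)) : Prop where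
  /-- `dM = dm(t) dt`, where every `m(t)` is a sub-probability measure on `[0,L]` and
  `t ↦ m(t,A)` is measurable for every Borel set `A`. -/
  disintegration : ∃ m : Kernel (Icc (0 : ℝ) T) (Icc (0 : ℝ) L),
    (∀ t, m t univ ≤ 1) ∧ M = timeMeasure T ⊗ₘ m
  /-- `b ∈ L²_M`. -/
  drift_memLp : MemLp b 2 M
  /-- The weak formulation. -/
  weak_formulation : ∀ φ : ℝ → ℝ → ℝ, IsTestFunction T L φ →
    ∫ p, dualOperator σ (b p) φ p.1 p.2 ∂M = ∫ x, φ 0 x ∂m₀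

end FokkerPlanck

/-!
Uniqueness is proved by duality. Write `L_b φ = -φ_t - (σ²/2) φ_xx + b φ_x`. If the equation
`L_b φ = ψ` could be solved by test functions, the weak formulation would determine `∫ ψ dM`. The
drift `b` is only in `L²(M)`, so it is replaced by smooth drifts `β` close to `b` in `L²` of both
solutions.

* The lateral boundary is a null set of every weak solution
  (`IsMeasureValuedWeakSolution.ae_ne_of_boundary`), so `b` may be approximated by smooth `β` odd
  about `x = 0` and about `x = L` (`exists_drift_approximation`). With right-hand sides `ψ` odd about
  `x = 0` and even about `x = L`, the boundary value problem becomes a problem on the whole line,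
  periodic in `x`, and the boundary conditions on `φ` follow from its symmetries.
* For such `β` and `ψ` the equation `L_β φ = ψ` is solved up to a small uniform error by a smooth
  function (`exists_approximate_dual_solution`): an iterate of the contraction built from the
  resolvent of the heat operator, which is an explicit Gaussian average. The maximum principle
  (`abs_le_of_abs_dual_le`) bounds `φ` by a constant independent of `β`.
* Since `L_b φ = L_β φ + (b - β) φ_x`, the error in `∫ ψ dM` is at most
  `‖b - β‖ ‖φ_x‖` in `L²(M)`. Testing the equation with `φ²` and using
  `L_b (φ²) = 2 φ L_b φ - σ² φ_x²` bounds `‖φ_x‖` in `L²(M)` by the supremum of `φ`, hence uniformly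
  in `β` (`IsMeasureValuedWeakSolution.duality_estimate`).

Hence two solutions agree on all such `ψ` (`integral_eq_of_drift_approximation`), and these are
sufficiently many to separate measures which do not charge `{t = T}` and `{x = 0}`.
-/

namespace FokkerPlanck

/-! ### Smooth periodic functions and their averages over translations -/

/-- Smooth functions of `(t,x) ∈ ℝ × ℝ` which are `P`-periodic in `x` and vanish for large `|t|`.
The class is stable under differentiation and its members are bounded, so that all derivatives
are bounded. -/
structure IsPeriodicSmooth {F : Type} [NormedAddCommGroup F] [NormedSpace ℝ F] (P : ℝ)
    (f : ℝ × ℝ → F) : Prop where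
  smooth : ContDiff ℝ ∞ f
  periodic : ∀ p, f (p + (0, P)) = f p
  vanish : ∃ R, ∀ p : ℝ × ℝ, R < |p.1| → f p = 0

section Average

variable {F : Type} [NormedAddCommGroup F] [NormedSpace ℝ F] {P : ℝ} {f : ℝ × ℝ → F}

lemma IsPeriodicSmooth.fderiv (hf : IsPeriodicSmooth P f) :
    IsPeriodicSmooth P (fderiv ℝ f) where
  smooth := (contDiff_infty_iff_fderiv.1 hf.smooth).2
  periodic p := by
    rw [← fderiv_comp_add_right]
    congr 1
    exact funext hf.periodic
  vanish := by
    obtain ⟨R, hR⟩ := hf.vanish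
    refine ⟨R, fun p hp => ?_⟩
    have hopen : IsOpen {q : ℝ × ℝ | R < |q.1|} :=
      isOpen_lt continuous_const continuous_fst.abs
    have : f =ᶠ[nhds p] fun _ => 0 :=
      Filter.eventually_of_mem (hopen.mem_nhds hp) hR
    rw [this.fderiv_eq, fderiv_fun_const]
    rfl

lemma IsPeriodicSmooth.clm_comp {G : Type} [NormedAddCommGroup G] [NormedSpace ℝ G]
    (hf : IsPeriodicSmooth P f) (B : F →L[ℝ] G) : IsPeriodicSmooth P (fun p => B (f p)) where
  smooth := B.contDiff.comp hf.smooth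
  periodic p := by rw [hf.periodic]
  vanish := by
    obtain ⟨R, hR⟩ := hf.vanish
    exact ⟨R, fun p hp => by rw [hR p hp, map_zero]⟩

lemma IsPeriodicSmooth.bounded (hP : 0 < P) (hf : IsPeriodicSmooth P f) :
    ∃ C, 0 ≤ C ∧ ∀ p, ‖f p‖ ≤ C := by
  obtain ⟨R, hR⟩ := hf.vanish
  obtain ⟨C, hC⟩ := ((isCompact_Icc (a := -R) (b := R)).prod
    (isCompact_Icc (a := (0 : ℝ)) (b := P))).exists_bound_of_continuousOn
    hf.smooth.continuous.continuousOn
  refine ⟨max C 0, le_max_right _ _, fun ⟨t, x⟩ => ?_⟩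
  by_cases ht : R < |t|
  · rw [hR _ ht, norm_zero]
    exact le_max_right _ _
  have hper : Function.Periodic (fun y => f (t, y)) P := fun y => by
    simpa using hf.periodic (t, y)
  obtain ⟨y, hy, hxy⟩ := hper.exists_mem_Ico₀ hP x
  rw [show f (t, x) = f (t, y) from hxy]
  exact (hC (t, y) ⟨abs_le.1 (not_lt.1 ht), Ico_subset_Icc_self hy⟩).trans (le_max_left _ _)

variable {A : Type} [MeasurableSpace A] {μ : Measure A} {k : A → ℝ} {Y : A → ℝ × ℝ}

/-- The average `p ↦ ∫ k(a) f(p + Y(a)) dμ(a)` of the translates of `f` with weight `k`. -/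
noncomputable def translationAverage (μ : Measure A) (k : A → ℝ) (Y : A → ℝ × ℝ)
    (f : ℝ × ℝ → F) (p : ℝ × ℝ) : F :=
  ∫ a, k a • f (p + Y a) ∂μ

lemma integrable_translate (hP : 0 < P) (hk : Integrable k μ) (hY : Measurable Y)
    (hf : IsPeriodicSmooth P f) (p : ℝ × ℝ) : Integrable (fun a => k a • f (p + Y a)) μ := by
  obtain ⟨C, -, hC⟩ := hf.bounded hP
  exact hk.smul_bdd C (hf.smooth.continuous.stronglyMeasurable.comp_measurable
    (measurable_const.add hY)).aestronglyMeasurable (ae_of_all _ fun a => hC _)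

lemma hasFDerivAt_translationAverage (hP : 0 < P) (hk : Integrable k μ) (hY : Measurable Y)
    (hf : IsPeriodicSmooth P f) (p : ℝ × ℝ) :
    HasFDerivAt (translationAverage μ k Y f) (translationAverage μ k Y (fderiv ℝ f) p) p := by
  obtain ⟨C, -, hC⟩ := hf.fderiv.bounded hP
  refine hasFDerivAt_integral_of_dominated_of_fderiv_le (bound := fun a => |k a| * C)
    (F := fun p a => k a • f (p + Y a))
    (F' := fun p a => k a • fderiv ℝ f (p + Y a)) Filter.univ_mem
    (Filter.Eventually.of_forall fun q =>
      (integrable_translate hP hk hY hf q).aestronglyMeasurable)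
    (integrable_translate hP hk hY hf p)
    (integrable_translate hP hk hY hf.fderiv p).aestronglyMeasurable
    (ae_of_all _ fun a q _ => ?_) (hk.abs.mul_const C) (ae_of_all _ fun a q _ => ?_)
  · rw [norm_smul, Real.norm_eq_abs]
    exact mul_le_mul_of_nonneg_left (hC _) (abs_nonneg _)
  · have hd := ((hf.smooth.differentiable (by simp)) (q + Y a)).hasFDerivAt
    exact ((hasFDerivAt_comp_add_right (Y a)).2 hd).const_smul (k a)

lemma contDiff_translationAverage (hP : 0 < P) (hk : Integrable k μ) (hY : Measurable Y)
    (hf : IsPeriodicSmooth P f) : ContDiff ℝ ∞ (translationAverage μ k Y f) := by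
  refine contDiff_infty.2 fun n => ?_
  induction n generalizing F with
  | zero =>
    refine contDiff_zero.2 (continuous_iff_continuousAt.2 fun p => ?_)
    exact (hasFDerivAt_translationAverage hP hk hY hf p).continuousAt
  | succ n ih =>
    exact contDiff_succ_iff_hasFDerivAt.2 ⟨_, ih hf.fderiv,
      hasFDerivAt_translationAverage hP hk hY hf⟩

end Average

/-! ### Partial derivatives -/

/-- The time derivative of a function of `(t,x)`. -/
noncomputable def dt (f : ℝ × ℝ → ℝ) (p : ℝ × ℝ) : ℝ := fderiv ℝ f p (1, 0)

/-- The space derivative of a function of `(t,x)`. -/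
noncomputable def dx (f : ℝ × ℝ → ℝ) (p : ℝ × ℝ) : ℝ := fderiv ℝ f p (0, 1)

section Partial

variable {P : ℝ} {f : ℝ × ℝ → ℝ}

lemma contDiff_dt (hf : ContDiff ℝ ∞ f) : ContDiff ℝ ∞ (dt f) :=
  (contDiff_infty_iff_fderiv.1 hf).2.clm_apply contDiff_const

lemma contDiff_dx (hf : ContDiff ℝ ∞ f) : ContDiff ℝ ∞ (dx f) :=
  (contDiff_infty_iff_fderiv.1 hf).2.clm_apply contDiff_const

lemma IsPeriodicSmooth.dt (hf : IsPeriodicSmooth P f) : IsPeriodicSmooth P (dt f) :=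
  hf.fderiv.clm_comp (ContinuousLinearMap.apply ℝ ℝ (1, 0))

lemma IsPeriodicSmooth.dx (hf : IsPeriodicSmooth P f) : IsPeriodicSmooth P (dx f) :=
  hf.fderiv.clm_comp (ContinuousLinearMap.apply ℝ ℝ (0, 1))

lemma hasDerivAt_dt (hf : ContDiff ℝ ∞ f) (t x : ℝ) :
    HasDerivAt (fun s => f (s, x)) (dt f (t, x)) t := by
  have h := ((hf.differentiable (by simp)) (t, x)).hasFDerivAt
  exact h.comp_hasDerivAt t ((hasDerivAt_id t).prodMk (hasDerivAt_const t x))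

lemma hasDerivAt_dx (hf : ContDiff ℝ ∞ f) (t x : ℝ) :
    HasDerivAt (fun y => f (t, y)) (dx f (t, x)) x := by
  have h := ((hf.differentiable (by simp)) (t, x)).hasFDerivAt
  exact h.comp_hasDerivAt x ((hasDerivAt_const x t).prodMk (hasDerivAt_id x))

/-- The dual operator of a smooth function in terms of `dt` and `dx`. -/
lemma dualOperator_eq (hf : ContDiff ℝ ∞ f) (σ β t x : ℝ) :
    dualOperator σ β (Function.curry f) t x =
      -dt f (t, x) - σ ^ 2 / 2 * dx (dx f) (t, x) + β * dx f (t, x) := by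
  have h1 : ∀ y, deriv (fun y => Function.curry f t y) y = dx f (t, y) := fun y =>
    (hasDerivAt_dx hf t y).deriv
  have h2 : deriv (fun s => Function.curry f s x) t = dt f (t, x) := (hasDerivAt_dt hf t x).deriv
  rw [dualOperator, h1, h2, iteratedDeriv_succ, iteratedDeriv_one, funext h1,
    (hasDerivAt_dx (contDiff_dx hf) t x).deriv]

/-- The symmetry `f(t, c - x) = ε f(t, x)`: for `ε = 1` the function is even about `c / 2`, and
for `ε = -1` it is odd about `c / 2`. -/
def IsSymmetric (c ε : ℝ) (f : ℝ × ℝ → ℝ) : Prop := ∀ t x, f (t, c - x) = ε * f (t, x)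

lemma IsSymmetric.dx {c ε : ℝ} (hs : IsSymmetric c ε f) (hf : ContDiff ℝ ∞ f) :
    IsSymmetric c (-ε) (dx f) := by
  intro t x
  have h1 : HasDerivAt (fun y => f (t, c - y)) (FokkerPlanck.dx f (t, c - x) * (-1)) x :=
    HasDerivAt.comp (h₂ := fun y => f (t, y)) x (hasDerivAt_dx hf t (c - x))
      (by simpa using (hasDerivAt_id x).const_sub c)
  have h2 : HasDerivAt (fun y => f (t, c - y)) (ε * FokkerPlanck.dx f (t, x)) x := by
    rw [show (fun y => f (t, c - y)) = fun y => ε * f (t, y) from funext (hs t)]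
    exact (hasDerivAt_dx hf t x).const_mul ε
  linarith [h1.unique h2]

lemma IsSymmetric.mul {c ε δ : ℝ} {g : ℝ × ℝ → ℝ} (hf : IsSymmetric c ε f)
    (hg : IsSymmetric c δ g) : IsSymmetric c (ε * δ) (fun p => f p * g p) := by
  intro t x
  simp only [hf t x, hg t x]
  ring

lemma IsSymmetric.sub {c ε : ℝ} {g : ℝ × ℝ → ℝ} (hf : IsSymmetric c ε f)
    (hg : IsSymmetric c ε g) : IsSymmetric c ε (fun p => f p - g p) := by
  intro t x
  simp only [hf t x, hg t x]
  ring

/-- A function with symmetries about `0` and about `L` is `4 L`-periodic. -/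
lemma periodic_of_isSymmetric {L ε δ : ℝ} (h0 : IsSymmetric 0 ε f) (hL : IsSymmetric (2 * L) δ f)
    (hε : ε * ε = 1) (hδ : δ * δ = 1) (p : ℝ × ℝ) : f (p + (0, 4 * L)) = f p := by
  obtain ⟨t, x⟩ := p
  have shift : ∀ y, f (t, y + 2 * L) = δ * ε * f (t, y) := fun y => by
    have e1 := hL t (-y)
    have e2 := h0 t y
    rw [show 2 * L - -y = y + 2 * L by ring] at e1
    rw [zero_sub] at e2
    rw [e1, e2, mul_assoc]
  have : (t, x) + (0, 4 * L) = (t, x + 2 * L + 2 * L) := by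
    ext <;> simp
    ring
  rw [this, shift, shift]
  linear_combination (f (t, x) * (ε * ε)) * hδ + f (t, x) * hε

lemma dx_eq_zero_of_vanish {τ : ℝ} (hf : ContDiff ℝ ∞ f)
    (hv : ∀ t x, τ ≤ t → f (t, x) = 0) : ∀ t x, τ ≤ t → dx f (t, x) = 0 := by
  intro t x ht
  have h := hasDerivAt_dx hf t x
  rw [show (fun y => f (t, y)) = fun _ => 0 from funext fun y => hv t y ht] at h
  exact h.unique (hasDerivAt_const x 0)

end Partial

/-! ### Gaussian integration by parts -/

lemma hasDerivAt_gaussianPDFReal (z : ℝ) :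
    HasDerivAt (gaussianPDFReal 0 1) (-(z * gaussianPDFReal 0 1 z)) z := by
  have h : gaussianPDFReal 0 1 = fun z => (√(2 * Real.pi))⁻¹ * Real.exp (-z ^ 2 / 2) := by
    ext z
    simp [gaussianPDFReal]
  have h1 : HasDerivAt (fun z : ℝ => -z ^ 2 / 2) (-z) z := by
    have := ((hasDerivAt_pow 2 z).neg).div_const 2
    exact this.congr_deriv (by norm_num; ring)
  rw [h]
  exact ((h1.exp).const_mul (√(2 * Real.pi))⁻¹).congr_deriv (by ring)

lemma integrable_id_gaussian : Integrable (fun z : ℝ => z) (gaussianReal 0 1) :=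
  memLp_one_iff_integrable.1 (memLp_id_gaussianReal 1)

/-- Stein's identity: Gaussian integration by parts. -/
lemma integral_mul_gaussian {g g' : ℝ → ℝ} {C : ℝ} (hg : ∀ z, HasDerivAt g (g' z) z)
    (hg' : Continuous g') (hC : ∀ z, ‖g z‖ ≤ C) (hC' : ∀ z, ‖g' z‖ ≤ C) :
    ∫ z, z * g z ∂gaussianReal 0 1 = ∫ z, g' z ∂gaussianReal 0 1 := by
  have hgc : Continuous g := continuous_iff_continuousAt.2 fun z => (hg z).continuousAt
  have hint : ∀ {f : ℝ → ℝ}, Integrable f (gaussianReal 0 1) →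
      Integrable (fun z => gaussianPDFReal 0 1 z * f z) := fun {f} hf => by
    rw [gaussianReal_of_var_ne_zero 0 one_ne_zero, integrable_withDensity_iff_integrable_smul'
      (measurable_gaussianPDF 0 1) (ae_of_all _ fun _ => gaussianPDF_lt_top)] at hf
    simpa [toReal_gaussianPDF] using hf
  have i1 : Integrable (fun z => z * g z) (gaussianReal 0 1) :=
    integrable_id_gaussian.mul_bdd hgc.aestronglyMeasurable (ae_of_all _ hC)
  have i2 : Integrable g' (gaussianReal 0 1) :=
    (integrable_const C).mono' hg'.aestronglyMeasurable (ae_of_all _ hC')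
  have i3 : Integrable g (gaussianReal 0 1) :=
    (integrable_const C).mono' hgc.aestronglyMeasurable (ae_of_all _ hC)
  have key := integral_mul_deriv_eq_deriv_mul_of_integrable (u := g) (u' := g')
    (v := gaussianPDFReal 0 1) (v' := fun z => -(z * gaussianPDFReal 0 1 z))
    (fun z _ => hg z) (fun z _ => hasDerivAt_gaussianPDFReal z)
    ((hint i1).neg.congr (ae_of_all _ fun z => by simp; ring))
    ((hint i2).congr (ae_of_all _ fun z => by simp; ring))
    ((hint i3).congr (ae_of_all _ fun z => by simp; ring))
  rw [integral_gaussianReal_eq_integral_smul one_ne_zero,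
    integral_gaussianReal_eq_integral_smul one_ne_zero]
  have e1 : ∫ z, g z * -(z * gaussianPDFReal 0 1 z) =
      -∫ z, gaussianPDFReal 0 1 z • (z * g z) := by
    rw [← integral_neg]
    exact integral_congr_ae (ae_of_all _ fun z => by simp; ring)
  rw [e1, neg_inj] at key
  rw [key]
  exact integral_congr_ae (ae_of_all _ fun z => by simp; ring)

/-! ### The resolvent of the backward heat operator -/

/-- The measure `dρ ⊗ N(0,1)` on `(0,∞) × ℝ`. -/
noncomputable def heatMeasure : Measure (ℝ × ℝ) :=
  (volume.restrict (Ioi 0)).prod (gaussianReal 0 1)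

instance : SFinite heatMeasure := by unfold heatMeasure; infer_instance

/-- The space-time displacement `(ρ², σ ρ z)` of the heat flow run for the time `r = ρ²`. The
variable `ρ = √r` makes the displacement smooth at `r = 0`. -/
def heatShift (σ : ℝ) (q : ℝ × ℝ) : ℝ × ℝ := (q.1 ^ 2, σ * q.1 * q.2)

/-- The weight `2 ρ exp(-κ ρ²)`, which is `exp(-κ r) dr` in the variable `ρ = √r`. -/
noncomputable def heatWeight (κ : ℝ) (q : ℝ × ℝ) : ℝ := 2 * (q.1 * Real.exp (-κ * q.1 ^ 2))

/-- The resolvent `(κ - ∂_t - (σ²/2) ∂_xx)⁻¹` of the backward heat operator, written as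
`u(t,x) = ∫₀^∞ exp(-κ r) 𝔼 f(t + r, x + σ √r Z) dr` with a standard Gaussian `Z`. -/
noncomputable def heatResolvent (κ σ : ℝ) (f : ℝ × ℝ → ℝ) : ℝ × ℝ → ℝ :=
  translationAverage heatMeasure (heatWeight κ) (heatShift σ) f

section Resolvent

variable {κ σ P : ℝ} {f : ℝ × ℝ → ℝ}

lemma continuous_heatShift : Continuous (heatShift σ) := by unfold heatShift; fun_prop

lemma integrable_heatWeight (hκ : 0 < κ) : Integrable (heatWeight κ) heatMeasure :=
  (((integrable_mul_exp_neg_mul_sq hκ).const_mul 2).integrableOn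
    (s := Ioi 0)).integrable.comp_fst (gaussianReal 0 1)

lemma contDiff_heatResolvent (hκ : 0 < κ) (hP : 0 < P) (hf : IsPeriodicSmooth P f) :
    ContDiff ℝ ∞ (heatResolvent κ σ f) :=
  contDiff_translationAverage hP (integrable_heatWeight hκ) continuous_heatShift.measurable hf

lemma fderiv_heatResolvent_apply (hκ : 0 < κ) (hP : 0 < P) (hf : IsPeriodicSmooth P f)
    (p v : ℝ × ℝ) :
    fderiv ℝ (heatResolvent κ σ f) p v = heatResolvent κ σ (fun q => fderiv ℝ f q v) p := by
  have hY := (continuous_heatShift (σ := σ)).measurable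
  have h := (hasFDerivAt_translationAverage hP (integrable_heatWeight hκ) hY hf p).fderiv
  rw [heatResolvent, h, translationAverage, ContinuousLinearMap.integral_apply
    (integrable_translate hP (integrable_heatWeight hκ) hY hf.fderiv p)]
  rfl

lemma dx_heatResolvent (hκ : 0 < κ) (hP : 0 < P) (hf : IsPeriodicSmooth P f) :
    dx (heatResolvent κ σ f) = heatResolvent κ σ (dx f) :=
  funext fun p => fderiv_heatResolvent_apply hκ hP hf p _

lemma dt_heatResolvent (hκ : 0 < κ) (hP : 0 < P) (hf : IsPeriodicSmooth P f) :
    dt (heatResolvent κ σ f) = heatResolvent κ σ (dt f) :=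
  funext fun p => fderiv_heatResolvent_apply hκ hP hf p _

/-- The resolvent as an iterated integral. -/
lemma heatResolvent_eq (hκ : 0 < κ) (hP : 0 < P) (hf : IsPeriodicSmooth P f) (p : ℝ × ℝ) :
    heatResolvent κ σ f p = ∫ ρ in Ioi (0 : ℝ), 2 * (ρ * Real.exp (-κ * ρ ^ 2)) *
      ∫ z, f (p + (ρ ^ 2, σ * ρ * z)) ∂gaussianReal 0 1 := by
  have h := integrable_translate hP (integrable_heatWeight hκ)
    (continuous_heatShift (σ := σ)).measurable hf p
  rw [heatResolvent, translationAverage, heatMeasure, integral_prod _ h]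
  simp only [heatWeight, heatShift, smul_eq_mul, integral_const_mul]

lemma integrable_gaussian_translate (hP : 0 < P) (hf : IsPeriodicSmooth P f) (p : ℝ × ℝ)
    (ρ : ℝ) : Integrable (fun z => f (p + (ρ ^ 2, σ * ρ * z))) (gaussianReal 0 1) := by
  obtain ⟨C, -, hC⟩ := hf.bounded hP
  refine (integrable_const C).mono' (Continuous.aestronglyMeasurable ?_)
    (ae_of_all _ fun z => hC _)
  exact hf.smooth.continuous.comp (by fun_prop)

/-- Gaussian integration by parts along the heat flow. -/
lemma gaussian_translate_dx (hP : 0 < P) (hf : IsPeriodicSmooth P f) (p : ℝ × ℝ) (ρ : ℝ) :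
    ∫ z, z * f (p + (ρ ^ 2, σ * ρ * z)) ∂gaussianReal 0 1 =
      σ * ρ * ∫ z, dx f (p + (ρ ^ 2, σ * ρ * z)) ∂gaussianReal 0 1 := by
  obtain ⟨C, hC0, hC⟩ := hf.bounded hP
  obtain ⟨D, hD0, hD⟩ := hf.dx.bounded hP
  rw [← integral_const_mul]
  have hcont : Continuous fun z : ℝ => p + (ρ ^ 2, σ * ρ * z) := by fun_prop
  refine integral_mul_gaussian (C := max C (|σ * ρ| * D)) (fun z => ?_)
    (continuous_const.mul (hf.dx.smooth.continuous.comp hcont))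
    (fun z => (hC _).trans (le_max_left _ _)) (fun z => ?_)
  · have h := HasDerivAt.comp (h₂ := fun y => f (p.1 + ρ ^ 2, y)) z
      (hasDerivAt_dx hf.smooth (p.1 + ρ ^ 2) (p.2 + σ * ρ * z))
      (((hasDerivAt_id z).const_mul (σ * ρ)).const_add p.2)
    exact h.congr_deriv (by rw [mul_one, mul_comm]; rfl)
  · rw [norm_mul, Real.norm_eq_abs]
    exact (mul_le_mul_of_nonneg_left (hD _) (abs_nonneg _)).trans (le_max_right _ _)

lemma heatResolvent_vanish {τ : ℝ} (hv : ∀ t x, τ ≤ t → f (t, x) = 0) :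
    ∀ t x, τ ≤ t → heatResolvent κ σ f (t, x) = 0 := by
  intro t x ht
  rw [heatResolvent, translationAverage]
  refine integral_eq_zero_of_ae (ae_of_all _ fun q => ?_)
  have : f ((t, x) + heatShift σ q) = 0 := hv _ _ (le_add_of_le_of_nonneg ht (sq_nonneg q.1))
  simp [this]

lemma heatResolvent_isSymmetric {c ε : ℝ} (hs : IsSymmetric c ε f) :
    IsSymmetric c ε (heatResolvent κ σ f) := by
  intro t x
  have hmp : MeasurePreserving (Prod.map id fun z : ℝ => -z) heatMeasure heatMeasure := by
    refine (MeasurePreserving.id _).prod ⟨measurable_neg, ?_⟩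
    simpa using gaussianReal_map_neg (μ := 0) (v := 1)
  have hemb : MeasurableEmbedding (Prod.map (id : ℝ → ℝ) fun z : ℝ => -z) :=
    ((MeasurableEquiv.refl ℝ).prodCongr (MeasurableEquiv.neg ℝ)).measurableEmbedding
  unfold heatResolvent translationAverage
  rw [← hmp.integral_comp hemb, ← integral_const_mul]
  refine integral_congr_ae (ae_of_all _ fun q => ?_)
  have h := hs (t + q.1 ^ 2) (x + σ * q.1 * q.2)
  simp only [heatWeight, heatShift, Prod.map, id, Prod.mk_add_mk, smul_eq_mul]
  rw [show c - x + σ * q.1 * -q.2 = c - (x + σ * q.1 * q.2) by ring, h]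
  ring

lemma heatResolvent_sub (hκ : 0 < κ) (hP : 0 < P) {g : ℝ × ℝ → ℝ} (hf : IsPeriodicSmooth P f)
    (hg : IsPeriodicSmooth P g) (p : ℝ × ℝ) :
    heatResolvent κ σ (fun q => f q - g q) p = heatResolvent κ σ f p - heatResolvent κ σ g p := by
  have hY := (continuous_heatShift (σ := σ)).measurable
  unfold heatResolvent translationAverage
  rw [← integral_sub (integrable_translate hP (integrable_heatWeight hκ) hY hf p)
    (integrable_translate hP (integrable_heatWeight hκ) hY hg p)]
  simp only [smul_sub]

/-- The gradient estimate `‖∂_x (κ - ∂_t - (σ²/2) ∂_xx)⁻¹ f‖ ≤ C κ^{-1/2} ‖f‖` in the sup norm. -/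
lemma abs_dx_heatResolvent_le (hσ : 0 < σ) : ∃ C, 0 < C ∧ ∀ κ P : ℝ, 0 < κ → 0 < P →
    ∀ f : ℝ × ℝ → ℝ, IsPeriodicSmooth P f → ∀ B, (∀ p, |f p| ≤ B) →
      ∀ p, |dx (heatResolvent κ σ f) p| ≤ C / √κ * B := by
  set m := ∫ z : ℝ, |z| ∂gaussianReal 0 1
  have hm : 0 ≤ m := integral_nonneg fun z => abs_nonneg z
  refine ⟨m * √Real.pi / σ + 1, by positivity, fun κ P hκ hP f hf B hB p => ?_⟩
  have hB0 : 0 ≤ B := (abs_nonneg _).trans (hB 0)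
  have inner : ∀ ρ : ℝ, |∫ z, z * f (p + (ρ ^ 2, σ * ρ * z)) ∂gaussianReal 0 1| ≤ m * B := by
    intro ρ
    rw [← integral_mul_const, ← Real.norm_eq_abs]
    refine norm_integral_le_of_norm_le (integrable_id_gaussian.abs.mul_const B)
      (ae_of_all _ fun z => ?_)
    rw [norm_mul, Real.norm_eq_abs, Real.norm_eq_abs]
    exact mul_le_mul_of_nonneg_left (hB _) (abs_nonneg _)
  have hexp : Integrable (fun ρ : ℝ => Real.exp (-κ * ρ ^ 2)) := integrable_exp_neg_mul_sq hκ
  rw [dx_heatResolvent hκ hP hf, heatResolvent_eq hκ hP hf.dx, ← Real.norm_eq_abs]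
  have hbound : ∀ ρ ∈ Ioi (0 : ℝ), ‖2 * (ρ * Real.exp (-κ * ρ ^ 2)) *
      ∫ z, dx f (p + (ρ ^ 2, σ * ρ * z)) ∂gaussianReal 0 1‖ ≤
        Real.exp (-κ * ρ ^ 2) * (2 / σ * (m * B)) := by
    intro ρ hρ
    have hρ : 0 < ρ := hρ
    -- The weight `2 ρ` compensates the factor `1 / (σ ρ)` of the integration by parts.
    have e : 2 * (ρ * Real.exp (-κ * ρ ^ 2)) *
        ∫ z, dx f (p + (ρ ^ 2, σ * ρ * z)) ∂gaussianReal 0 1 =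
        Real.exp (-κ * ρ ^ 2) * (2 / σ *
          ∫ z, z * f (p + (ρ ^ 2, σ * ρ * z)) ∂gaussianReal 0 1) := by
      rw [gaussian_translate_dx hP hf]
      field_simp
    rw [e, Real.norm_eq_abs, abs_mul, abs_mul, Real.abs_exp, abs_of_pos (by positivity : 0 < 2 / σ)]
    gcongr
    exact inner ρ
  refine (norm_integral_le_of_norm_le (hexp.integrableOn.mul_const _)
    ((ae_restrict_iff' measurableSet_Ioi).2 (ae_of_all _ hbound))).trans ?_
  rw [integral_mul_const, integral_gaussian_Ioi, Real.sqrt_div Real.pi_nonneg]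
  have hsq : 0 < √κ := Real.sqrt_pos.2 hκ
  have : √Real.pi / √κ / 2 * (2 / σ * (m * B)) = (m * √Real.pi / σ) / √κ * B := by
    field_simp
  rw [this]
  gcongr
  linarith

lemma hasDerivAt_gaussian_translate (hP : 0 < P) (hf : IsPeriodicSmooth P f) (p : ℝ × ℝ)
    (ρ : ℝ) :
    HasDerivAt (fun ρ => ∫ z, f (p + (ρ ^ 2, σ * ρ * z)) ∂gaussianReal 0 1)
      (2 * ρ * (∫ z, dt f (p + (ρ ^ 2, σ * ρ * z)) ∂gaussianReal 0 1 +
        σ ^ 2 / 2 * ∫ z, dx (dx f) (p + (ρ ^ 2, σ * ρ * z)) ∂gaussianReal 0 1)) ρ := by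
  obtain ⟨C, hC0, hC⟩ := hf.dt.bounded hP
  obtain ⟨D, hD0, hD⟩ := hf.dx.bounded hP
  have hcont : ∀ r : ℝ, Continuous fun z : ℝ => p + (r ^ 2, σ * r * z) := fun r => by fun_prop
  have hcf : Continuous f := hf.smooth.continuous
  have hcx : Continuous (dx f) := hf.dx.smooth.continuous
  have i1 := (integrable_gaussian_translate (σ := σ) hP hf.dt p ρ).const_mul (2 * ρ)
  have i2 : Integrable (fun z => σ * (z * dx f (p + (ρ ^ 2, σ * ρ * z)))) (gaussianReal 0 1) :=
    (integrable_id_gaussian.mul_bdd (hcx.comp (hcont ρ)).aestronglyMeasurable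
      (ae_of_all _ fun z => hD _)).const_mul σ
  have h := (hasDerivAt_integral_of_dominated_loc_of_deriv_le (μ := gaussianReal 0 1)
    (F := fun r z => f (p + (r ^ 2, σ * r * z)))
    (F' := fun r z => 2 * r * dt f (p + (r ^ 2, σ * r * z)) +
      σ * (z * dx f (p + (r ^ 2, σ * r * z))))
    (bound := fun z => 2 * (|ρ| + 1) * C + |σ| * (|z| * D)) (Metric.ball_mem_nhds ρ one_pos)
    (Filter.Eventually.of_forall fun r => (hcf.comp (hcont r)).aestronglyMeasurable)
    (integrable_gaussian_translate hP hf p ρ) (i1.add i2).aestronglyMeasurable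
    (ae_of_all _ fun z r hr => ?_)
    ((integrable_const _).add ((integrable_id_gaussian.abs.mul_const D).const_mul |σ|))
    (ae_of_all _ fun z r _ => ?_)).2
  · refine h.congr_deriv ?_
    rw [integral_add i1 i2, integral_const_mul, integral_const_mul,
      gaussian_translate_dx hP hf.dx]
    ring
  · have hr' : |r| ≤ |ρ| + 1 := by
      rw [Metric.mem_ball, Real.dist_eq] at hr
      linarith [abs_sub_abs_le_abs_sub r ρ]
    refine (norm_add_le _ _).trans (add_le_add ?_ ?_)
    · rw [norm_mul, norm_mul, Real.norm_ofNat, Real.norm_eq_abs]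
      gcongr
      exact hC _
    · rw [norm_mul, norm_mul, Real.norm_eq_abs, Real.norm_eq_abs]
      gcongr
      exact hD _
  · have hd := ((hf.smooth.differentiable (by simp)) (p + (r ^ 2, σ * r * z))).hasFDerivAt
    have hc : HasDerivAt (fun r : ℝ => p + (r ^ 2, σ * r * z)) (2 * r, σ * z) r := by
      have e1 : HasDerivAt (fun r : ℝ => r ^ 2) (2 * r) r := by simpa using hasDerivAt_pow 2 r
      have e2 : HasDerivAt (fun r : ℝ => σ * r * z) (σ * z) r := by
        simpa using ((hasDerivAt_id r).const_mul σ).mul_const z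
      exact (e1.prodMk e2).const_add p
    refine (hd.comp_hasDerivAt r hc).congr_deriv ?_
    rw [show ((2 * r, σ * z) : ℝ × ℝ) = (2 * r) • (1, 0) + (σ * z) • (0, 1) by ext <;> simp,
      map_add, map_smul, map_smul, smul_eq_mul, smul_eq_mul, mul_assoc σ z]
    rfl

/-- The resolvent solves the backward heat equation. Integration by parts in `ρ` turns the
weight `2 ρ exp(-κ ρ²)` into the term `κ u`, and the boundary term at `ρ = 0` is `f`. -/
lemma heatResolvent_equation (hκ : 0 < κ) (hP : 0 < P) (hf : IsPeriodicSmooth P f) (p : ℝ × ℝ) :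
    -dt (heatResolvent κ σ f) p - σ ^ 2 / 2 * dx (dx (heatResolvent κ σ f)) p +
      κ * heatResolvent κ σ f p = f p := by
  obtain ⟨C, hC0, hC⟩ := hf.bounded hP
  rw [dt_heatResolvent hκ hP hf, dx_heatResolvent hκ hP hf, dx_heatResolvent hκ hP hf.dx]
  set H : ℝ → ℝ := fun ρ => ∫ z, f (p + (ρ ^ 2, σ * ρ * z)) ∂gaussianReal 0 1 with hH
  set w : ℝ → ℝ := fun ρ => 2 * (ρ * Real.exp (-κ * ρ ^ 2)) with hw
  have hHb : ∀ ρ, |H ρ| ≤ C := fun ρ => by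
    have := norm_integral_le_of_norm_le_const (μ := gaussianReal 0 1)
      (ae_of_all _ fun z => hC (p + (ρ ^ 2, σ * ρ * z)))
    simpa using this
  have hint : ∀ {g : ℝ × ℝ → ℝ}, IsPeriodicSmooth P g → IntegrableOn (fun ρ => w ρ *
      ∫ z, g (p + (ρ ^ 2, σ * ρ * z)) ∂gaussianReal 0 1) (Ioi 0) := fun {g} hg => by
    have h := integrable_translate hP (integrable_heatWeight hκ)
      (continuous_heatShift (σ := σ)).measurable hg p
    have h2 := h.integral_prod_left
    simp only [heatWeight, heatShift, smul_eq_mul, integral_const_mul] at h2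
    exact h2
  have hE : ∀ ρ : ℝ, HasDerivAt (fun ρ => Real.exp (-κ * ρ ^ 2)) (-κ * w ρ) ρ := fun ρ => by
    have e1 : HasDerivAt (fun r : ℝ => -κ * r ^ 2) (-κ * (2 * ρ)) ρ := by
      simpa using (hasDerivAt_pow 2 ρ).const_mul (-κ)
    exact e1.exp.congr_deriv (by simp only [hw]; ring)
  have hEH := fun ρ => (hE ρ).mul (hasDerivAt_gaussian_translate (σ := σ) hP hf p ρ)
  have hlim : Filter.Tendsto (fun ρ => Real.exp (-κ * ρ ^ 2) * H ρ) Filter.atTop (nhds 0) := by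
    have hexp : Filter.Tendsto (fun ρ : ℝ => Real.exp (-κ * ρ ^ 2)) Filter.atTop (nhds 0) := by
      refine Real.tendsto_exp_atBot.comp ?_
      exact (Filter.tendsto_pow_atTop two_ne_zero).const_mul_atTop_of_neg (neg_neg_of_pos hκ)
    have := hexp.zero_mul_isBoundedUnder_le (g := H)
      (Filter.isBoundedUnder_of ⟨C, fun ρ => by simpa using hHb ρ⟩)
    exact this
  have key := integral_Ioi_of_hasDerivAt_of_tendsto (a := (0 : ℝ))
    (hEH 0).continuousAt.continuousWithinAt (fun ρ _ => hEH ρ) ?_ hlim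
  · rw [heatResolvent_eq hκ hP hf, heatResolvent_eq hκ hP hf.dt, heatResolvent_eq hκ hP hf.dx.dx]
    have e : ∀ ρ : ℝ, -κ * w ρ * H ρ + Real.exp (-κ * ρ ^ 2) *
        (2 * ρ * (∫ z, dt f (p + (ρ ^ 2, σ * ρ * z)) ∂gaussianReal 0 1 +
        σ ^ 2 / 2 * ∫ z, dx (dx f) (p + (ρ ^ 2, σ * ρ * z)) ∂gaussianReal 0 1)) =
        -κ * (w ρ * H ρ) + (w ρ * ∫ z, dt f (p + (ρ ^ 2, σ * ρ * z)) ∂gaussianReal 0 1 +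
        σ ^ 2 / 2 * (w ρ * ∫ z, dx (dx f) (p + (ρ ^ 2, σ * ρ * z)) ∂gaussianReal 0 1)) := by
      intro ρ
      simp only [hw]
      ring
    have h0 : H 0 = f p := by simp [hH, show p + (0, 0) = p from add_zero p]
    have i3 : IntegrableOn (fun ρ => σ ^ 2 / 2 *
        (w ρ * ∫ z, dx (dx f) (p + (ρ ^ 2, σ * ρ * z)) ∂gaussianReal 0 1)) (Ioi 0) :=
      (hint hf.dx.dx).const_mul _
    have i2 : IntegrableOn (fun ρ => w ρ * ∫ z, dt f (p + (ρ ^ 2, σ * ρ * z)) ∂gaussianReal 0 1 +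
        σ ^ 2 / 2 * (w ρ * ∫ z, dx (dx f) (p + (ρ ^ 2, σ * ρ * z)) ∂gaussianReal 0 1)) (Ioi 0) :=
      (hint hf.dt).add i3
    have i1 : IntegrableOn (fun ρ => -κ * (w ρ * H ρ)) (Ioi 0) := (hint hf).const_mul _
    rw [setIntegral_congr_fun measurableSet_Ioi (fun ρ _ => e ρ), integral_add i1 i2,
      integral_add (hint hf.dt) i3, integral_const_mul, integral_const_mul] at key
    change _ = 0 - Real.exp (-κ * 0 ^ 2) * H 0 at key
    rw [h0, zero_pow two_ne_zero, mul_zero, Real.exp_zero, one_mul] at key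
    simp only [hw, hH] at key
    linarith
  · refine (((hint hf).const_mul (-κ)).add ((hint hf.dt).add
      ((hint hf.dx.dx).const_mul (σ ^ 2 / 2)))).congr (ae_of_all _ fun ρ => ?_)
    simp only [Pi.add_apply, hw]
    ring

end Resolvent

/-! ### Approximate solutions of the dual equation -/

section Dual

variable {P : ℝ} {f g : ℝ × ℝ → ℝ}

lemma IsPeriodicSmooth.mul (hf : IsPeriodicSmooth P f) (hg : ContDiff ℝ ∞ g)
    (hper : ∀ p, g (p + (0, P)) = g p) : IsPeriodicSmooth P (fun p => f p * g p) where
  smooth := hf.smooth.mul hg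
  periodic p := by rw [hf.periodic, hper]
  vanish := by
    obtain ⟨R, hR⟩ := hf.vanish
    exact ⟨R, fun p hp => by rw [hR p hp, zero_mul]⟩

lemma IsPeriodicSmooth.sub (hf : IsPeriodicSmooth P f) (hg : IsPeriodicSmooth P g) :
    IsPeriodicSmooth P (fun p => f p - g p) where
  smooth := hf.smooth.sub hg.smooth
  periodic p := by rw [hf.periodic, hg.periodic]
  vanish := by
    obtain ⟨R, hR⟩ := hf.vanish
    obtain ⟨S, hS⟩ := hg.vanish
    exact ⟨max R S, fun p hp => by
      rw [hR p ((le_max_left _ _).trans_lt hp), hS p ((le_max_right _ _).trans_lt hp), sub_zero]⟩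

lemma dx_periodic (hper : ∀ p, f (p + (0, P)) = f p) (p : ℝ × ℝ) :
    dx f (p + (0, P)) = dx f p := by
  unfold dx
  rw [← fderiv_comp_add_right, show (fun x => f (x + (0, P))) = f from funext hper]

lemma dx_heatResolvent_sub {κ σ : ℝ} (hκ : 0 < κ) (hP : 0 < P) (hf : IsPeriodicSmooth P f)
    (hg : IsPeriodicSmooth P g) (p : ℝ × ℝ) :
    dx (heatResolvent κ σ (fun q => f q - g q)) p =
      dx (heatResolvent κ σ f) p - dx (heatResolvent κ σ g) p := by
  have h1 := (contDiff_heatResolvent (σ := σ) hκ hP hf).differentiable (by simp) p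
  have h2 := (contDiff_heatResolvent (σ := σ) hκ hP hg).differentiable (by simp) p
  unfold dx
  rw [funext (heatResolvent_sub (σ := σ) hκ hP hf hg), fderiv_fun_sub h1 h2]
  rfl

/-- The effect on the dual operator of the factor `exp(-κ t)`: a zeroth order term `κ w`. -/
lemma dual_exp_mul {w : ℝ × ℝ → ℝ} (hw : ContDiff ℝ ∞ w) (κ σ β : ℝ) (p : ℝ × ℝ) :
    -dt (fun p => Real.exp (-κ * p.1) * w p) p -
      σ ^ 2 / 2 * dx (dx fun p => Real.exp (-κ * p.1) * w p) p +
      β * dx (fun p => Real.exp (-κ * p.1) * w p) p =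
    Real.exp (-κ * p.1) *
      ((-dt w p - σ ^ 2 / 2 * dx (dx w) p + κ * w p) + β * dx w p) := by
  have hexp : ContDiff ℝ ∞ fun p : ℝ × ℝ => Real.exp (-κ * p.1) := by fun_prop
  have hX : ∀ {v : ℝ × ℝ → ℝ}, ContDiff ℝ ∞ v →
      dx (fun p => Real.exp (-κ * p.1) * v p) = fun p => Real.exp (-κ * p.1) * dx v p := by
    intro v hv
    ext ⟨t, x⟩
    exact (hasDerivAt_dx (hexp.mul hv) t x).unique ((hasDerivAt_dx hv t x).const_mul (Real.exp (-κ * t)))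
  have hT : dt (fun p => Real.exp (-κ * p.1) * w p) p =
      Real.exp (-κ * p.1) * (-κ) * w p + Real.exp (-κ * p.1) * dt w p := by
    obtain ⟨t, x⟩ := p
    have he : HasDerivAt (fun s : ℝ => Real.exp (-κ * s)) (Real.exp (-κ * t) * (-κ)) t := by
      simpa using ((hasDerivAt_id t).const_mul (-κ)).exp
    exact (hasDerivAt_dt (hexp.mul hw) t x).unique (he.mul (hasDerivAt_dt hw t x))
  rw [hX hw, hX (contDiff_dx hw), hT]
  ring

/-- The dual equation with smooth, suitably symmetric drift `β` and right-hand side `ψ` is solved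
up to an arbitrarily small uniform error by a smooth function with the symmetries of `ψ`.

With `φ = exp(-κ t) w` and `w = (κ - ∂_t - (σ²/2) ∂_xx)⁻¹ f`, the equation is the fixed point
equation `f = exp(κ t) ψ - β ∂_x (κ - ∂_t - (σ²/2) ∂_xx)⁻¹ f`, which is a contraction for large
`κ` by the gradient estimate. An iterate is smooth, so no regularity theory for the fixed point is
needed. -/
lemma exists_approximate_dual_solution {σ L τ ε : ℝ} (hσ : 0 < σ) (hL : 0 < L) (hε : 0 < ε)
    {β ψ : ℝ × ℝ → ℝ} (hβ : IsPeriodicSmooth (4 * L) β) (hβ0 : IsSymmetric 0 (-1) β)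
    (hβL : IsSymmetric (2 * L) (-1) β) (hψ : IsPeriodicSmooth (4 * L) ψ)
    (hψ0 : IsSymmetric 0 (-1) ψ) (hψL : IsSymmetric (2 * L) 1 ψ)
    (hψv : ∀ t x, τ ≤ t → ψ (t, x) = 0) :
    ∃ φ : ℝ × ℝ → ℝ, ContDiff ℝ ∞ φ ∧ IsSymmetric 0 (-1) φ ∧ IsSymmetric (2 * L) 1 φ ∧
      (∀ t x, τ ≤ t → φ (t, x) = 0) ∧ ∀ p : ℝ × ℝ, 0 ≤ p.1 →
        |-dt φ p - σ ^ 2 / 2 * dx (dx φ) p + β p * dx φ p - ψ p| ≤ ε := by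
  have hP : 0 < 4 * L := by positivity
  obtain ⟨B, hB0, hB⟩ := hβ.bounded hP
  obtain ⟨C, hC0, hC⟩ := abs_dx_heatResolvent_le hσ
  -- `κ` is chosen such that the contraction factor `B C / √κ` is at most `1 / 2`.
  obtain ⟨κ, hκ, hκB⟩ : ∃ κ, 0 < κ ∧ B * (C / √κ) ≤ 1 / 2 := by
    refine ⟨(2 * C * B + 1) ^ 2, by positivity, ?_⟩
    rw [Real.sqrt_sq (by positivity), mul_div_assoc', div_le_iff₀ (by positivity)]
    linarith
  set g : ℝ × ℝ → ℝ := fun p => ψ p * Real.exp (κ * p.1) with hgdef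
  have hg : IsPeriodicSmooth (4 * L) g :=
    hψ.mul (by fun_prop) fun p => by rw [Prod.fst_add, add_zero]
  have hg0 : IsSymmetric 0 (-1) g := fun t x => by
    simp only [hgdef, hψ0 t x]
    ring
  have hgL : IsSymmetric (2 * L) 1 g := fun t x => by
    simp only [hgdef, hψL t x]
    ring
  have hgv : ∀ t x, τ ≤ t → g (t, x) = 0 := fun t x ht => by simp [hgdef, hψv t x ht]
  let step : (ℝ × ℝ → ℝ) → ℝ × ℝ → ℝ := fun f p => g p - β p * dx (heatResolvent κ σ f) p
  let F : ℕ → ℝ × ℝ → ℝ := fun n => step^[n] g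
  have hsucc : ∀ n, F (n + 1) = step (F n) := fun n => Function.iterate_succ_apply' step n g
  have inv : ∀ n, IsPeriodicSmooth (4 * L) (F n) ∧ IsSymmetric 0 (-1) (F n) ∧
      IsSymmetric (2 * L) 1 (F n) ∧ ∀ t x, τ ≤ t → F n (t, x) = 0 := by
    intro n
    induction n with
    | zero => exact ⟨hg, hg0, hgL, hgv⟩
    | succ n ih =>
      obtain ⟨i1, i2, i3, i4⟩ := ih
      have hw := contDiff_heatResolvent (σ := σ) hκ hP i1
      have s0 := heatResolvent_isSymmetric (κ := κ) (σ := σ) i2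
      have sL := heatResolvent_isSymmetric (κ := κ) (σ := σ) i3
      rw [hsucc]
      refine ⟨hg.sub (hβ.mul (contDiff_dx hw) (dx_periodic (periodic_of_isSymmetric s0 sL
          (by norm_num) (by norm_num)))),
        hg0.sub ?_, hgL.sub ?_, fun t x ht => ?_⟩
      · have := hβ0.mul (s0.dx hw)
        rwa [neg_neg, mul_one] at this
      · have := hβL.mul (sL.dx hw)
        rwa [neg_mul_neg, mul_one] at this
      · simp only [step]
        rw [hgv t x ht, dx_eq_zero_of_vanish hw (heatResolvent_vanish i4) t x ht, mul_zero,
          sub_zero]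
  obtain ⟨D, hD0, hD⟩ := ((inv 1).1.sub (inv 0).1).bounded hP
  have hdiff : ∀ n p, |F (n + 1) p - F n p| ≤ (1 / 2) ^ n * D := by
    intro n
    induction n with
    | zero => simpa using hD
    | succ n ih =>
      intro p
      have e : F (n + 1 + 1) p - F (n + 1) p =
          -(β p * dx (heatResolvent κ σ fun q => F (n + 1) q - F n q) p) := by
        rw [dx_heatResolvent_sub hκ hP (inv (n + 1)).1 (inv n).1, show F (n + 1 + 1) p =
          g p - β p * dx (heatResolvent κ σ (F (n + 1))) p from congrFun (hsucc (n + 1)) p,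
          show F (n + 1) p = g p - β p * dx (heatResolvent κ σ (F n)) p from congrFun (hsucc n) p]
        ring
      rw [e, abs_neg, abs_mul]
      have h1 := hC κ _ hκ hP _ ((inv (n + 1)).1.sub (inv n).1) _ ih p
      calc _ ≤ B * (C / √κ * ((1 / 2) ^ n * D)) :=
            mul_le_mul (hB p) h1 (abs_nonneg _) hB0
        _ = B * (C / √κ) * ((1 / 2) ^ n * D) := by ring
        _ ≤ 1 / 2 * ((1 / 2) ^ n * D) := by gcongr
        _ = _ := by ring
  obtain ⟨n, hn⟩ : ∃ n : ℕ, (1 / 2) ^ n * D ≤ ε := by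
    have : Filter.Tendsto (fun n : ℕ => (1 / 2 : ℝ) ^ n * D) Filter.atTop (nhds (0 * D)) :=
      (tendsto_pow_atTop_nhds_zero_of_lt_one (by norm_num) (by norm_num)).mul_const D
    rw [zero_mul] at this
    exact ((this.eventually (ge_mem_nhds hε))).exists
  obtain ⟨i1, i2, i3, i4⟩ := inv n
  have hw := contDiff_heatResolvent (σ := σ) hκ hP i1
  refine ⟨fun p => Real.exp (-κ * p.1) * heatResolvent κ σ (F n) p,
    ContDiff.mul (by fun_prop) hw, fun t x => ?_, fun t x => ?_, fun t x ht => ?_, fun p hp => ?_⟩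
  · simp only [heatResolvent_isSymmetric i2 t x]
    ring
  · simp only [heatResolvent_isSymmetric i3 t x]
    ring
  · simp only [heatResolvent_vanish i4 t x ht, mul_zero]
  · rw [dual_exp_mul hw, heatResolvent_equation hκ hP i1]
    have hψg : ψ p = Real.exp (-κ * p.1) * g p := by
      rw [hgdef, mul_left_comm, ← Real.exp_add]
      simp
    have e : F n p + β p * dx (heatResolvent κ σ (F n)) p - g p = -(F (n + 1) p - F n p) := by
      rw [hsucc]
      simp only [step]
      ring
    rw [hψg, ← mul_sub, e, abs_mul, abs_neg, Real.abs_exp]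
    have h1 : Real.exp (-κ * p.1) ≤ 1 := Real.exp_le_one_iff.2 (by nlinarith)
    calc _ ≤ 1 * ((1 / 2) ^ n * D) := by
          gcongr
          exact hdiff n p
      _ ≤ ε := by rwa [one_mul]

end Dual

/-! ### The maximum principle -/

section MaximumPrinciple

lemma deriv_nonpos_of_right_max {v : ℝ → ℝ} {v' t T : ℝ} (hv : HasDerivAt v v' t) (ht : t < T)
    (hmax : ∀ s ∈ Ioo t T, v s ≤ v t) : v' ≤ 0 := by
  have h := hasDerivWithinAt_iff_tendsto_slope.1 (hv.hasDerivWithinAt (s := Ioi t))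
  rw [sdiff_singleton_eq_self (by simp)] at h
  refine le_of_tendsto h ?_
  filter_upwards [Ioo_mem_nhdsGT ht] with s hs
  rw [slope_def_field]
  exact div_nonpos_of_nonpos_of_nonneg (by linarith [hmax s hs]) (by linarith [hs.1])

lemma second_deriv_nonpos_of_max {v v' : ℝ → ℝ} {v'' x : ℝ} (hv : ∀ y, HasDerivAt v (v' y) y)
    (hv' : HasDerivAt v' v'' x) (hmax : ∀ y, v y ≤ v x) : v' x = 0 ∧ v'' ≤ 0 := by
  have hd : deriv v = v' := funext fun y => (hv y).deriv
  have hlm : IsLocalMax v x := Filter.Eventually.of_forall hmax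
  have h0 : v' x = 0 := by rw [← hd, hlm.deriv_eq_zero]
  refine ⟨h0, not_lt.1 fun hpos => ?_⟩
  have hmin : IsLocalMin v x := by
    refine isLocalMin_of_deriv_deriv_pos ?_ ?_ (hv x).continuousAt
    · rwa [hd, hv'.deriv]
    · rw [hd, h0]
  -- A maximum which is also a minimum has a constant neighbourhood.
  have hconst : v =ᶠ[nhds x] fun _ => v x := by
    filter_upwards [hmin] with y hy using le_antisymm (hmax y) hy
  have : deriv v =ᶠ[nhds x] fun _ => 0 := by
    filter_upwards [hconst.eventuallyEq_nhds] with y hy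
    rw [hy.deriv_eq, deriv_const]
  rw [hd] at this
  have := this.deriv_eq
  rw [hv'.deriv, deriv_const] at this
  exact hpos.ne' this

lemma le_of_dual_le {φ : ℝ × ℝ → ℝ} {β : ℝ × ℝ → ℝ} {σ T P C : ℝ} (hT : 0 < T) (hP : 0 < P)
    (hφ : ContDiff ℝ ∞ φ) (hper : ∀ p, φ (p + (0, P)) = φ p) (hend : ∀ x, φ (T, x) = 0)
    (hle : ∀ p : ℝ × ℝ, 0 ≤ p.1 →
      -dt φ p - σ ^ 2 / 2 * dx (dx φ) p + β p * dx φ p ≤ C) :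
    ∀ t ∈ Icc 0 T, ∀ x, φ (t, x) ≤ C * (T - t) := by
  have hperx : ∀ t, Function.Periodic (fun y => φ (t, y)) P := fun t y => by
    simpa using hper (t, y)
  have main : ∀ ε > 0, ∀ t ∈ Icc 0 T, ∀ x, φ (t, x) ≤ (C + ε) * (T - t) := by
    intro ε hε t ht x
    obtain ⟨⟨t₀, x₀⟩, ⟨ht₀, hx₀⟩, hmax⟩ := ((isCompact_Icc (a := 0) (b := T)).prod
      (isCompact_Icc (a := 0) (b := P))).exists_isMaxOn
      ⟨(0, 0), ⟨le_rfl, hT.le⟩, ⟨le_rfl, hP.le⟩⟩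
      (f := fun p : ℝ × ℝ => φ p - (C + ε) * (T - p.1))
      (hφ.continuous.sub (by fun_prop)).continuousOn
    have hglob : ∀ s ∈ Icc 0 T, ∀ y,
        φ (s, y) - (C + ε) * (T - s) ≤ φ (t₀, x₀) - (C + ε) * (T - t₀) := by
      intro s hs y
      obtain ⟨z, hz, hyz⟩ := (hperx s).exists_mem_Ico₀ hP y
      rw [show φ (s, y) = φ (s, z) from hyz]
      exact hmax (show (s, z) ∈ Icc 0 T ×ˢ Icc 0 P from ⟨hs, Ico_subset_Icc_self hz⟩)
    rcases ht₀.2.eq_or_lt with heq | hlt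
    · have := hglob t ht x
      simp only at heq
      rw [heq, hend] at this
      linarith
    · exfalso
      have hx := second_deriv_nonpos_of_max (hasDerivAt_dx hφ t₀)
        (hasDerivAt_dx (contDiff_dx hφ) t₀ x₀) fun y => by linarith [hglob t₀ ht₀ y]
      have hder : HasDerivAt (fun s => φ (s, x₀) - (C + ε) * (T - s))
          (dt φ (t₀, x₀) - (C + ε) * (-1)) t₀ :=
        (hasDerivAt_dt hφ t₀ x₀).sub (((hasDerivAt_id t₀).const_sub T).const_mul _)
      have htd := deriv_nonpos_of_right_max hder hlt fun s hs =>
        hglob s ⟨ht₀.1.trans hs.1.le, hs.2.le⟩ x₀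
      have h := hle (t₀, x₀) ht₀.1
      rw [hx.1] at h
      nlinarith [sq_nonneg σ, hx.2, mul_nonneg (sq_nonneg σ) (neg_nonneg.2 hx.2)]
  intro t ht x
  refine le_of_forall_pos_le_add fun δ hδ => ?_
  have h := main (δ / T) (by positivity) t ht x
  have : δ / T * (T - t) ≤ δ := by
    rw [div_mul_eq_mul_div, div_le_iff₀ hT]
    nlinarith [ht.1]
  linarith

/-- The maximum principle for the backward equation with zero final value, on functions which are
periodic in space: there is no boundary, and no regularity of the drift `β` is needed. -/
lemma abs_le_of_abs_dual_le {φ : ℝ × ℝ → ℝ} {β : ℝ × ℝ → ℝ} {σ T P C : ℝ} (hT : 0 < T)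
    (hP : 0 < P) (hφ : ContDiff ℝ ∞ φ) (hper : ∀ p, φ (p + (0, P)) = φ p)
    (hend : ∀ x, φ (T, x) = 0)
    (hle : ∀ p : ℝ × ℝ, 0 ≤ p.1 →
      |-dt φ p - σ ^ 2 / 2 * dx (dx φ) p + β p * dx φ p| ≤ C) :
    ∀ t ∈ Icc 0 T, ∀ x, |φ (t, x)| ≤ C * T := by
  intro t ht x
  have hC : 0 ≤ C := (abs_nonneg _).trans (hle (0, 0) le_rfl)
  have hX : ∀ f : ℝ × ℝ → ℝ, dx (fun p => -f p) = fun p => -dx f p := fun f => by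
    ext p
    simp [dx, fderiv_fun_neg]
  have hD : dt (fun p => -φ p) = fun p => -dt φ p := by
    ext p
    simp [dt, fderiv_fun_neg]
  have h1 := le_of_dual_le (β := β) hT hP hφ hper hend
    (fun p hp => (le_abs_self _).trans (hle p hp)) t ht x
  have h2 := le_of_dual_le (β := β) (σ := σ) (C := C) hT hP hφ.neg (fun p => by rw [hper])
    (fun x => by rw [hend, neg_zero])
    (fun p hp => by
      rw [hX, hX, hD]
      have := (neg_le_abs _).trans (hle p hp)
      linarith) t ht x
  have h3 : C * (T - t) ≤ C * T := by nlinarith [ht.1]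
  exact abs_le.2 ⟨by linarith, by linarith⟩

end MaximumPrinciple

/-! ### Testing the weak formulation -/

section Duality

variable {σ T L : ℝ} {b : Icc (0 : ℝ) T × Icc (0 : ℝ) L → ℝ} {m₀ : Measure (Icc (0 : ℝ) L)}
  {M : Measure (Icc (0 : ℝ) T × Icc (0 : ℝ) L)}

/-- The inclusion of `[0,T] × [0,L]` into the plane. -/
def toPlane (p : Icc (0 : ℝ) T × Icc (0 : ℝ) L) : ℝ × ℝ := (p.1, p.2)

lemma continuous_toPlane : Continuous (toPlane (T := T) (L := L)) := by
  unfold toPlane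
  fun_prop

lemma continuous_comp_toPlane {f : ℝ × ℝ → ℝ} (hf : Continuous f) :
    Continuous fun p : Icc (0 : ℝ) T × Icc (0 : ℝ) L => f (toPlane p) :=
  hf.comp continuous_toPlane

instance : IsFiniteMeasure (timeMeasure T) := by
  refine ⟨?_⟩
  rw [timeMeasure, (MeasurableEmbedding.subtype_coe measurableSet_Icc).comap_apply]
  exact (measure_mono (Subtype.coe_image_subset _ _)).trans_lt measure_Icc_lt_top

lemma IsMeasureValuedWeakSolution.isFiniteMeasure
    (h : IsMeasureValuedWeakSolution σ T L b m₀ M) : IsFiniteMeasure M := by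
  obtain ⟨m, hm, rfl⟩ := h.disintegration
  have : IsFiniteKernel m := ⟨1, ENNReal.one_lt_top, hm⟩
  infer_instance

lemma integrable_comp_toPlane [IsFiniteMeasure M] {f : ℝ × ℝ → ℝ} (hf : Continuous f) :
    Integrable (fun p => f (toPlane p)) M :=
  (continuous_comp_toPlane hf).integrable_of_hasCompactSupport (.of_compactSpace _)

lemma memLp_comp_toPlane [IsFiniteMeasure M] {f : ℝ × ℝ → ℝ} (hf : Continuous f) :
    MemLp (fun p => f (toPlane p)) 2 M :=
  (continuous_comp_toPlane hf).memLp_of_hasCompactSupport (.of_compactSpace _)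

lemma isTestFunction_curry {φ : ℝ × ℝ → ℝ} {τ : ℝ} (hτ : τ < T) (hφ : ContDiff ℝ ∞ φ)
    (hv : ∀ t x, τ ≤ t → φ (t, x) = 0) (hD : ∀ t, φ (t, 0) = 0) (hN : ∀ t, dx φ (t, L) = 0) :
    IsTestFunction T L (Function.curry φ) where
  smooth := by rwa [Function.uncurry_curry]
  compact_support := by
    refine ⟨Icc 0 τ ×ˢ Icc 0 L, isCompact_Icc.prod isCompact_Icc,
      prod_mono (fun t ht => ⟨ht.1, ht.2.trans_lt hτ⟩) subset_rfl, fun p hp hpK => ?_⟩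
    refine hv _ _ (not_lt.1 fun hlt => hpK ⟨⟨hp.1.1, hlt.le⟩, hp.2⟩)
  dirichlet t _ := hD t
  neumann t _ := (hasDerivAt_dx hφ t L).deriv.trans (hN t)

lemma IsMeasureValuedWeakSolution.test (h : IsMeasureValuedWeakSolution σ T L b m₀ M)
    {φ : ℝ × ℝ → ℝ} {τ : ℝ} (hτ : τ < T) (hφ : ContDiff ℝ ∞ φ)
    (hv : ∀ t x, τ ≤ t → φ (t, x) = 0) (hD : ∀ t, φ (t, 0) = 0) (hN : ∀ t, dx φ (t, L) = 0) :
    ∫ p, (-dt φ (toPlane p) - σ ^ 2 / 2 * dx (dx φ) (toPlane p) + b p * dx φ (toPlane p)) ∂M =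
      ∫ x, φ (0, (x : ℝ)) ∂m₀ := by
  have := h.weak_formulation _ (isTestFunction_curry hτ hφ hv hD hN)
  simp only [dualOperator_eq hφ] at this
  exact this

lemma integral_const_add_mul_add_mul [IsFiniteMeasure M]
    {f g : Icc (0 : ℝ) T × Icc (0 : ℝ) L → ℝ} (hf : Integrable f M) (hg : Integrable g M)
    (a r s : ℝ) :
    ∫ p, (a + (r * f p + s * g p)) ∂M =
      a * M.real univ + (r * ∫ p, f p ∂M + s * ∫ p, g p ∂M) := by
  have i : Integrable (fun p => r * f p + s * g p) M := (hf.const_mul r).add (hg.const_mul s)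
  rw [integral_add (integrable_const a) i, integral_add (hf.const_mul r) (hg.const_mul s),
    integral_const_mul, integral_const_mul, integral_const, smul_eq_mul, mul_comm a]

lemma integrable_drift_mul [IsFiniteMeasure M] {c : Icc (0 : ℝ) T × Icc (0 : ℝ) L → ℝ}
    (hc : MemLp c 2 M) {f : ℝ × ℝ → ℝ} (hf : Continuous f) :
    Integrable (fun p => c p * f (toPlane p)) M :=
  hc.integrable_mul (memLp_comp_toPlane hf)

/-- The chain rule for squares. The dual operator is a diffusion operator, whence the extra term
`-σ² φ_x²` which provides the energy estimate. -/
lemma dual_sq {φ : ℝ × ℝ → ℝ} (hφ : ContDiff ℝ ∞ φ) (p : ℝ × ℝ) :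
    dx (fun p => φ p ^ 2) p = 2 * φ p * dx φ p ∧ ∀ σ β : ℝ,
      -dt (fun p => φ p ^ 2) p - σ ^ 2 / 2 * dx (dx fun p => φ p ^ 2) p +
        β * dx (fun p => φ p ^ 2) p =
      2 * φ p * (-dt φ p - σ ^ 2 / 2 * dx (dx φ) p + β * dx φ p) - σ ^ 2 * dx φ p ^ 2 := by
  have h1 : ∀ p, dx (fun p => φ p ^ 2) p = 2 * φ p * dx φ p := fun ⟨t, x⟩ =>
    (hasDerivAt_dx (hφ.pow 2) t x).unique (((hasDerivAt_dx hφ t x).pow 2).congr_deriv (by simp))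
  obtain ⟨t, x⟩ := p
  have h2 : dt (fun p => φ p ^ 2) (t, x) = 2 * φ (t, x) * dt φ (t, x) :=
    (hasDerivAt_dt (hφ.pow 2) t x).unique (((hasDerivAt_dt hφ t x).pow 2).congr_deriv (by simp))
  have h3 : dx (dx fun p => φ p ^ 2) (t, x) =
      2 * dx φ (t, x) * dx φ (t, x) + 2 * φ (t, x) * dx (dx φ) (t, x) := by
    rw [funext h1]
    exact (hasDerivAt_dx ((contDiff_const.mul hφ).mul (contDiff_dx hφ)) t x).unique
      (((hasDerivAt_dx hφ t x).const_mul 2).mul (hasDerivAt_dx (contDiff_dx hφ) t x))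
  refine ⟨h1 _, fun σ β => ?_⟩
  rw [h1, h2, h3]
  ring

/-- The duality estimate. If `φ` solves the dual equation with drift `β` and right-hand side `ψ`
approximately, then `∫ ψ dM` is determined by `m₀` up to an error controlled by the distance of
`β` and `b` in `L²(M)`. The constant does not involve any derivative of `φ`: testing with `φ²`
bounds `φ_x` in `L²(M)` by the supremum of `φ`. -/
lemma IsMeasureValuedWeakSolution.duality_estimate
    (h : IsMeasureValuedWeakSolution σ T L b m₀ M) (hσ : 0 < σ) {φ β ψ : ℝ × ℝ → ℝ} {τ A S η : ℝ}
    (hτ : τ < T) (hφ : ContDiff ℝ ∞ φ) (hv : ∀ t x, τ ≤ t → φ (t, x) = 0)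
    (hD : ∀ t, φ (t, 0) = 0) (hN : ∀ t, dx φ (t, L) = 0) (hβ : Continuous β)
    (hψ : Continuous ψ) (hS : ∀ p, |ψ p| ≤ S) (hη : 0 < η) (hη1 : η ≤ 1)
    (hA : ∀ p : Icc (0 : ℝ) T × Icc (0 : ℝ) L, |φ (toPlane p)| ≤ A)
    (heq : ∀ p : ℝ × ℝ, 0 ≤ p.1 →
      |-dt φ p - σ ^ 2 / 2 * dx (dx φ) p + β p * dx φ p - ψ p| ≤ η)
    (hb : ∫ p, (b p - β (toPlane p)) ^ 2 ∂M ≤ η ^ 2) :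
    |∫ p, ψ (toPlane p) ∂M - ∫ x, φ (0, (x : ℝ)) ∂m₀| ≤
      η * (M.real univ + 1 / 2 + (2 * A * (S + 1) * M.real univ + 2 * A ^ 2 / σ ^ 2) / σ ^ 2) := by
  have hfin := h.isFiniteMeasure
  have hφc := hφ.continuous
  have hφx := (contDiff_dx hφ).continuous
  have hφt := (contDiff_dt hφ).continuous
  have hφxx := (contDiff_dx (contDiff_dx hφ)).continuous
  set c : Icc (0 : ℝ) T × Icc (0 : ℝ) L → ℝ := fun p => b p - β (toPlane p) with hc
  have hcL : MemLp c 2 M := h.drift_memLp.sub (memLp_comp_toPlane hβ)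
  have ic : Integrable (fun p => c p ^ 2) M := hcL.integrable_sq
  have iX : Integrable (fun p => dx φ (toPlane p) ^ 2) M := integrable_comp_toPlane (hφx.pow 2)
  set D : Icc (0 : ℝ) T × Icc (0 : ℝ) L → ℝ := fun p =>
    -dt φ (toPlane p) - σ ^ 2 / 2 * dx (dx φ) (toPlane p) + b p * dx φ (toPlane p) with hDdef
  have iD : Integrable D M :=
    (integrable_comp_toPlane (f := fun p => -dt φ p - σ ^ 2 / 2 * dx (dx φ) p)
      (by fun_prop)).add (integrable_drift_mul h.drift_memLp hφx)
  have hDψ : ∀ p, |D p - ψ (toPlane p) - c p * dx φ (toPlane p)| ≤ η := fun p => by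
    have := heq (toPlane p) p.1.2.1
    convert this using 2
    simp only [hDdef, hc]
    ring
  have hA0 : ∀ p : Icc (0 : ℝ) T × Icc (0 : ℝ) L, 0 ≤ A := fun p => (abs_nonneg _).trans (hA p)
  -- The energy estimate, from the test function `φ²`.
  have energy : σ ^ 2 / 2 * ∫ p, dx φ (toPlane p) ^ 2 ∂M ≤
      2 * A * (S + 1) * M.real univ + 2 * A ^ 2 / σ ^ 2 := by
    have ht := h.test (φ := fun p => φ p ^ 2) hτ (hφ.pow 2)
      (fun t x htx => by rw [hv t x htx, zero_pow two_ne_zero])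
      (fun t => by rw [hD t, zero_pow two_ne_zero])
      (fun t => by rw [(dual_sq hφ _).1, hN, mul_zero])
    simp only [(dual_sq hφ _).2] at ht
    have hpos : 0 ≤ ∫ x, φ (0, ((x : Icc (0 : ℝ) L) : ℝ)) ^ 2 ∂m₀ :=
      integral_nonneg fun x => sq_nonneg _
    have i1 : Integrable (fun p => 2 * φ (toPlane p) * D p) M := by
      refine (iD.bdd_mul (c := |2| * A)
        (continuous_comp_toPlane (continuous_const.mul hφc)).aestronglyMeasurable
        (ae_of_all _ fun p => ?_))
      rw [Real.norm_eq_abs, abs_mul]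
      exact mul_le_mul_of_nonneg_left (hA p) (abs_nonneg _)
    rw [integral_sub i1 (iX.const_mul _), integral_const_mul] at ht
    have hle : ∫ p, 2 * φ (toPlane p) * D p ∂M ≤
        ∫ p, (2 * A * (S + 1) + (σ ^ 2 / 2 * dx φ (toPlane p) ^ 2 +
          2 * A ^ 2 / σ ^ 2 * c p ^ 2)) ∂M := by
      refine integral_mono i1 ((integrable_const _).add
        ((iX.const_mul _).add (ic.const_mul _))) fun p => ?_
      set X := dx φ (toPlane p)
      set f := φ (toPlane p)
      have hf : |f| ≤ A := hA p
      have hAp := hA0 p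
      have hDp : |D p - c p * X| ≤ S + 1 := by
        have e : D p - c p * X = (D p - ψ (toPlane p) - c p * X) + ψ (toPlane p) := by ring
        rw [e]
        linarith [abs_add_le (D p - ψ (toPlane p) - c p * X) (ψ (toPlane p)), hDψ p,
          hS (toPlane p)]
      have e1 : f * (D p - c p * X) ≤ A * (S + 1) := by
        refine (le_abs_self _).trans ?_
        rw [abs_mul]
        exact mul_le_mul hf hDp (abs_nonneg _) hAp
      have e2 : 2 * (f * (c p * X)) ≤ σ ^ 2 / 2 * X ^ 2 + 2 * A ^ 2 / σ ^ 2 * c p ^ 2 := by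
        have hsq : f ^ 2 ≤ A ^ 2 := sq_le_sq' (abs_le.1 hf).1 (abs_le.1 hf).2
        -- Young's inequality, with half of the energy `σ² X²` to be absorbed.
        have e3 : 2 * (f * (c p * X)) ≤ σ ^ 2 / 2 * X ^ 2 + 2 * f ^ 2 / σ ^ 2 * c p ^ 2 := by
          have : σ ^ 2 / 2 * X ^ 2 + 2 * f ^ 2 / σ ^ 2 * c p ^ 2 - 2 * (f * (c p * X)) =
              1 / 2 * (σ * X - 2 * f / σ * c p) ^ 2 := by
            field_simp
            ring
          refine sub_nonneg.1 ?_
          rw [this]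
          positivity
        have e4 : 2 * f ^ 2 / σ ^ 2 * c p ^ 2 ≤ 2 * A ^ 2 / σ ^ 2 * c p ^ 2 := by gcongr
        exact e3.trans (add_le_add_right e4 _)
      calc 2 * f * D p = 2 * (f * (D p - c p * X)) + 2 * (f * (c p * X)) := by ring
        _ ≤ _ := by linarith
    rw [integral_const_add_mul_add_mul iX ic] at hle
    have hc1 : 2 * A ^ 2 / σ ^ 2 * ∫ p, c p ^ 2 ∂M ≤ 2 * A ^ 2 / σ ^ 2 :=
      mul_le_of_le_one_right (by positivity) (hb.trans (pow_le_one₀ hη.le hη1))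
    linarith
  have htest : ∫ p, D p ∂M = ∫ x, φ (0, (x : ℝ)) ∂m₀ := h.test hτ hφ hv hD hN
  have iψ : Integrable (fun p => ψ (toPlane p)) M := integrable_comp_toPlane hψ
  rw [← htest, ← integral_sub iψ iD, ← Real.norm_eq_abs]
  have hbound : ‖∫ p, (ψ (toPlane p) - D p) ∂M‖ ≤
      ∫ p, (η + (1 / (2 * η) * c p ^ 2 + η / 2 * dx φ (toPlane p) ^ 2)) ∂M := by
    refine norm_integral_le_of_norm_le ((integrable_const _).add
        ((ic.const_mul _).add (iX.const_mul _))) (ae_of_all _ fun p => ?_)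
    set X := dx φ (toPlane p)
    have e1 : |c p * X| ≤ 1 / (2 * η) * c p ^ 2 + η / 2 * X ^ 2 := by
      rw [abs_mul, ← sq_abs (c p), ← sq_abs X]
      have : 1 / (2 * η) * |c p| ^ 2 + η / 2 * |X| ^ 2 - |c p| * |X| =
          1 / (2 * η) * (|c p| - η * |X|) ^ 2 := by
        field_simp
        ring
      have h2 : 0 ≤ 1 / (2 * η) * (|c p| - η * |X|) ^ 2 := by positivity
      linarith
    have e : ψ (toPlane p) - D p = -((D p - ψ (toPlane p) - c p * X) + c p * X) := by ring
    rw [e, norm_neg, Real.norm_eq_abs]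
    linarith [abs_add_le (D p - ψ (toPlane p) - c p * X) (c p * X), hDψ p]
  refine hbound.trans ?_
  rw [integral_const_add_mul_add_mul ic iX]
  have e1 : 1 / (2 * η) * ∫ p, c p ^ 2 ∂M ≤ η * (1 / 2) := by
    calc _ ≤ 1 / (2 * η) * η ^ 2 := by gcongr
      _ = _ := by field_simp
  have e2 : η / 2 * ∫ p, dx φ (toPlane p) ^ 2 ∂M ≤
      η * ((2 * A * (S + 1) * M.real univ + 2 * A ^ 2 / σ ^ 2) / σ ^ 2) := by
    rw [div_mul_eq_mul_div, mul_div_assoc]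
    refine mul_le_mul_of_nonneg_left ?_ hη.le
    rw [le_div_iff₀ (by positivity)]
    linarith
  linarith

/-- Two weak solutions agree on every smooth symmetric function, provided that the drift is
approximated in `L²` of both solutions by smooth symmetric drifts. -/
lemma integral_eq_of_drift_approximation {M₁ M₂ : Measure (Icc (0 : ℝ) T × Icc (0 : ℝ) L)}
    (hσ : 0 < σ) (hT : 0 < T) (hL : 0 < L)
    (h₁ : IsMeasureValuedWeakSolution σ T L b m₀ M₁)
    (h₂ : IsMeasureValuedWeakSolution σ T L b m₀ M₂)
    (happrox : ∀ η > 0, ∃ β : ℝ × ℝ → ℝ, IsPeriodicSmooth (4 * L) β ∧ IsSymmetric 0 (-1) β ∧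
      IsSymmetric (2 * L) (-1) β ∧ ∫ p, (b p - β (toPlane p)) ^ 2 ∂M₁ ≤ η ∧
      ∫ p, (b p - β (toPlane p)) ^ 2 ∂M₂ ≤ η)
    {ψ : ℝ × ℝ → ℝ} {τ : ℝ} (hτ : τ < T) (hψ : IsPeriodicSmooth (4 * L) ψ)
    (hψ0 : IsSymmetric 0 (-1) ψ) (hψL : IsSymmetric (2 * L) 1 ψ)
    (hψv : ∀ t x, τ ≤ t → ψ (t, x) = 0) :
    ∫ p, ψ (toPlane p) ∂M₁ = ∫ p, ψ (toPlane p) ∂M₂ := by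
  obtain ⟨S, hS0, hS⟩ := hψ.bounded (by positivity)
  set A := (S + 1) * T
  set K : Measure (Icc (0 : ℝ) T × Icc (0 : ℝ) L) → ℝ := fun M =>
    M.real univ + 1 / 2 + (2 * A * (S + 1) * M.real univ + 2 * A ^ 2 / σ ^ 2) / σ ^ 2 with hK
  have key : ∀ η, 0 < η → η ≤ 1 →
      |∫ p, ψ (toPlane p) ∂M₁ - ∫ p, ψ (toPlane p) ∂M₂| ≤ η * (K M₁ + K M₂) := by
    intro η hη hη1
    obtain ⟨β, hβ, hβ0, hβL, hb1, hb2⟩ := happrox (η ^ 2) (by positivity)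
    obtain ⟨φ, hφ, hφ0, hφL, hφv, heq⟩ :=
      exists_approximate_dual_solution hσ hL hη hβ hβ0 hβL hψ hψ0 hψL hψv
    have hA : ∀ p : Icc (0 : ℝ) T × Icc (0 : ℝ) L, |φ (toPlane p)| ≤ A := fun p =>
      abs_le_of_abs_dual_le (σ := σ) (β := β) (C := S + 1) hT (by positivity) hφ
        (periodic_of_isSymmetric hφ0 hφL (by norm_num) (by norm_num))
        (fun x => hφv T x hτ.le) (fun q hq => by
          have e := abs_add_le (-dt φ q - σ ^ 2 / 2 * dx (dx φ) q + β q * dx φ q - ψ q) (ψ q)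
          rw [sub_add_cancel] at e
          have := hS q
          rw [Real.norm_eq_abs] at this
          linarith [heq q hq]) p.1 p.1.2 p.2
    have hD : ∀ t, φ (t, 0) = 0 := fun t => by
      have := hφ0 t 0
      rw [sub_zero] at this
      linarith
    have hN : ∀ t, dx φ (t, L) = 0 := fun t => by
      have := hφL.dx hφ t L
      rw [show 2 * L - L = L by ring] at this
      linarith
    have d1 := h₁.duality_estimate hσ hτ hφ hφv hD hN hβ.smooth.continuous hψ.smooth.continuous
      hS hη hη1 hA heq hb1
    have d2 := h₂.duality_estimate hσ hτ hφ hφv hD hN hβ.smooth.continuous hψ.smooth.continuous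
      hS hη hη1 hA heq hb2
    rw [abs_sub_comm] at d2
    have := abs_sub_le (∫ p, ψ (toPlane p) ∂M₁) (∫ x, φ (0, (x : ℝ)) ∂m₀)
      (∫ p, ψ (toPlane p) ∂M₂)
    simp only [hK]
    linarith
  have hK0 : 0 ≤ K M₁ + K M₂ := by
    have hAn : 0 ≤ A := by positivity
    simp only [hK]
    positivity
  refine eq_of_abs_sub_nonpos (le_of_forall_pos_le_add fun δ hδ => ?_)
  refine (key (min 1 (δ / (K M₁ + K M₂ + 1))) (by positivity) (min_le_left _ _)).trans ?_
  calc _ ≤ δ / (K M₁ + K M₂ + 1) * (K M₁ + K M₂) := by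
        gcongr
        exact min_le_right _ _
    _ ≤ 0 + δ := by
      rw [zero_add, div_mul_eq_mul_div, div_le_iff₀ (by positivity)]
      nlinarith

end Duality

/-! ### No mass on the lateral boundary and at the final time -/

/-- A smooth cutoff in time, equal to `1` on `[0, τ - 1]`, positive on `[0, τ)` and zero on
`[τ, ∞)` and on `(-∞, -1]`. -/
noncomputable def timeCutoff (τ t : ℝ) : ℝ :=
  Real.smoothTransition (t + 1) * Real.smoothTransition (τ - t)

section Cutoff

variable {τ t : ℝ}

lemma contDiff_timeCutoff : ContDiff ℝ ∞ (timeCutoff τ) := by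
  have h : ContDiff ℝ ∞ Real.smoothTransition := Real.smoothTransition.contDiff (n := ⊤)
  exact (h.comp (contDiff_id.add contDiff_const)).mul (h.comp (contDiff_const.sub contDiff_id))

lemma timeCutoff_eq_one (h0 : 0 ≤ t) (h1 : t + 1 ≤ τ) : timeCutoff τ t = 1 := by
  rw [timeCutoff, Real.smoothTransition.one_of_one_le (by linarith),
    Real.smoothTransition.one_of_one_le (by linarith), one_mul]

lemma timeCutoff_pos (h0 : 0 ≤ t) (h1 : t < τ) : 0 < timeCutoff τ t :=
  mul_pos (Real.smoothTransition.pos_of_pos (by linarith))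
    (Real.smoothTransition.pos_of_pos (by linarith))

lemma timeCutoff_nonneg : 0 ≤ timeCutoff τ t :=
  mul_nonneg (Real.smoothTransition.nonneg _) (Real.smoothTransition.nonneg _)

lemma timeCutoff_eq_zero (h : τ ≤ t) : timeCutoff τ t = 0 := by
  rw [timeCutoff, Real.smoothTransition.zero_of_nonpos (by linarith : τ - t ≤ 0), mul_zero]

lemma timeCutoff_eq_zero_of_le (h : t ≤ -1) : timeCutoff τ t = 0 := by
  rw [timeCutoff, Real.smoothTransition.zero_of_nonpos (by linarith : t + 1 ≤ 0), zero_mul]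

end Cutoff

/-- A smooth function which is `y²/2` near the origin and vanishes for `|y| ≥ 1`. -/
lemma exists_smooth_quadratic_bump : ∃ ζ ζ' ζ'' : ℝ → ℝ, ∃ C, 0 ≤ C ∧ ContDiff ℝ ∞ ζ ∧
    (∀ y, HasDerivAt ζ (ζ' y) y) ∧ (∀ y, HasDerivAt ζ' (ζ'' y) y) ∧
    ζ 0 = 0 ∧ ζ' 0 = 0 ∧ ζ'' 0 = 1 ∧
    (∀ y, 1 < |y| → ζ y = 0 ∧ ζ' y = 0 ∧ ζ'' y = 0) ∧
    ∀ y, |ζ y| ≤ C ∧ |ζ' y| ≤ C ∧ |ζ'' y| ≤ C := by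
  let χ : ContDiffBump (0 : ℝ) := ⟨1 / 2, 1, by norm_num, by norm_num⟩
  let ζ : ℝ → ℝ := fun y => y ^ 2 / 2 * χ y
  have hζ : ContDiff ℝ ∞ ζ := ((contDiff_id.pow 2).div_const 2).mul χ.contDiff
  have hζ' : ContDiff ℝ ∞ (deriv ζ) := (contDiff_infty_iff_deriv.1 hζ).2
  have hζ'' : ContDiff ℝ ∞ (deriv (deriv ζ)) := (contDiff_infty_iff_deriv.1 hζ').2
  have hcs : HasCompactSupport ζ := χ.hasCompactSupport.mul_left
  obtain ⟨C₀, hC₀⟩ := hcs.exists_bound_of_continuous hζ.continuous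
  obtain ⟨C₁, hC₁⟩ := hcs.deriv.exists_bound_of_continuous hζ'.continuous
  obtain ⟨C₂, hC₂⟩ := hcs.deriv.deriv.exists_bound_of_continuous hζ''.continuous
  have near : ζ =ᶠ[nhds 0] fun y => y ^ 2 / 2 := by
    filter_upwards [χ.eventuallyEq_one] with y hy
    simp [ζ, hy]
  have dquad : deriv (fun y : ℝ => y ^ 2 / 2) = fun y => y := by
    ext y
    simp
  have near' : deriv ζ =ᶠ[nhds 0] fun y => y := by
    have := near.deriv
    rwa [dquad] at this
  have hopen : IsOpen {y : ℝ | 1 < |y|} := isOpen_lt continuous_const continuous_abs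
  have zero₀ : ∀ y ∈ {y : ℝ | 1 < |y|}, ζ y = 0 := fun y hy => by
    have : χ y = 0 := χ.zero_of_le_dist (by simpa using hy.le)
    simp [ζ, this]
  have zero₁ : ∀ y ∈ {y : ℝ | 1 < |y|}, deriv ζ y = 0 := fun y hy => by
    rw [(Filter.eventuallyEq_of_mem (hopen.mem_nhds hy) zero₀ : ζ =ᶠ[nhds y] fun _ => 0).deriv_eq,
      deriv_const]
  have zero₂ : ∀ y ∈ {y : ℝ | 1 < |y|}, deriv (deriv ζ) y = 0 := fun y hy => by
    rw [(Filter.eventuallyEq_of_mem (hopen.mem_nhds hy) zero₁ :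
      deriv ζ =ᶠ[nhds y] fun _ => 0).deriv_eq, deriv_const]
  refine ⟨ζ, deriv ζ, deriv (deriv ζ), max C₀ (max C₁ C₂), ?_, hζ,
    fun y => (hζ.differentiable (by simp) y).hasDerivAt,
    fun y => (hζ'.differentiable (by simp) y).hasDerivAt, near.eq_of_nhds.trans (by norm_num),
    near'.eq_of_nhds, by rw [near'.deriv_eq, deriv_id''],
    fun y hy => ⟨zero₀ y hy, zero₁ y hy, zero₂ y hy⟩, fun y => ⟨?_, ?_, ?_⟩⟩
  · exact (norm_nonneg _).trans ((hC₀ 0).trans (le_max_left _ _))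
  · exact (hC₀ y).trans (le_max_left _ _)
  · exact (hC₁ y).trans ((le_max_left _ _).trans (le_max_right _ _))
  · exact (hC₂ y).trans ((le_max_right _ _).trans (le_max_right _ _))

section NullSets

variable {σ T L : ℝ} {b : Icc (0 : ℝ) T × Icc (0 : ℝ) L → ℝ} {m₀ : Measure (Icc (0 : ℝ) L)}
  {M : Measure (Icc (0 : ℝ) T × Icc (0 : ℝ) L)}

lemma IsMeasureValuedWeakSolution.ae_time_lt (h : IsMeasureValuedWeakSolution σ T L b m₀ M) :
    ∀ᵐ p ∂M, (p.1 : ℝ) < T := by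
  obtain ⟨m, hm, rfl⟩ := h.disintegration
  have : IsFiniteKernel m := ⟨1, ENNReal.one_lt_top, hm⟩
  rw [Measure.ae_compProd_iff (measurableSet_lt (by fun_prop) measurable_const)]
  have hae : ∀ᵐ t : Icc (0 : ℝ) T ∂timeMeasure T, (t : ℝ) < T := by
    rw [ae_iff, timeMeasure,
      (MeasurableEmbedding.subtype_coe measurableSet_Icc).comap_apply]
    refine measure_mono_null (t := {T}) ?_ Real.volume_singleton
    rintro _ ⟨t, ht, rfl⟩
    exact le_antisymm t.2.2 (not_lt.1 ht)
  filter_upwards [hae] with t ht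
  exact ae_of_all _ fun _ => ht

/-- A weak solution does not charge the lateral boundary. The test functions
`θ(t) ε² ζ((x - c) / ε)`, with `ζ` quadratic at the origin, tend to zero together with their first
derivatives, whereas their second space derivatives tend to the indicator of `{x = c}`. -/
lemma IsMeasureValuedWeakSolution.ae_ne_of_boundary
    (h : IsMeasureValuedWeakSolution σ T L b m₀ M) [IsFiniteMeasure m₀] (hσ : 0 < σ) (hL : 0 < L)
    {c : ℝ} (hc : c = 0 ∨ c = L) : ∀ᵐ p ∂M, (p.2 : ℝ) ≠ c := by
  have hfin := h.isFiniteMeasure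
  obtain ⟨ζ, ζ', ζ'', C, hC0, hζ, hd, hd', z0, z0', z0'', hout, hbd⟩ :=
    exists_smooth_quadratic_bump
  -- The statement for times before `τ < T`.
  have main : ∀ τ < T, ∀ᵐ p ∂M, timeCutoff τ p.1 = 0 ∨ (p.2 : ℝ) ≠ c := by
    intro τ hτ
    set θ := timeCutoff τ with hθdef
    have hθ : ContDiff ℝ ∞ θ := contDiff_timeCutoff
    have hθ' : Continuous (deriv θ) := (contDiff_infty_iff_deriv.1 hθ).2.continuous
    obtain ⟨D, hD⟩ := (isCompact_Icc (a := 0) (b := T)).exists_bound_of_continuousOn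
      hθ.continuous.continuousOn
    obtain ⟨D', hD'⟩ := (isCompact_Icc (a := 0) (b := T)).exists_bound_of_continuousOn
      hθ'.continuousOn
    let ε : ℕ → ℝ := fun n => L / (n + 2)
    have hε : ∀ n, 0 < ε n := fun n => by positivity
    have hεL : ∀ n, ε n ≤ L := fun n => div_le_self hL.le (by norm_cast; omega)
    have hε2 : ∀ n, 1 < |L / ε n| := fun n => by
      have : L / ε n = n + 2 := by
        simp only [ε]
        field_simp
      rw [this, abs_of_nonneg (by positivity)]
      norm_cast
      omega
    have hεlim : Filter.Tendsto ε Filter.atTop (nhds 0) := by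
      have : Filter.Tendsto (fun n : ℕ => (n : ℝ) + 2) Filter.atTop Filter.atTop :=
        Filter.tendsto_atTop_add_const_right _ _ tendsto_natCast_atTop_atTop
      exact this.const_div_atTop L
    let φ : ℕ → ℝ × ℝ → ℝ := fun n p => θ p.1 * (ε n ^ 2 * ζ ((p.2 - c) / ε n))
    have hφ : ∀ n, ContDiff ℝ ∞ (φ n) := fun n =>
      (hθ.comp contDiff_fst).mul (contDiff_const.mul
        (hζ.comp ((contDiff_snd.sub contDiff_const).div_const _)))
    have hscale : ∀ n x, HasDerivAt (fun y => (y - c) / ε n) (1 / ε n) x := fun n x =>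
      ((hasDerivAt_id x).sub_const c).div_const _
    have hX : ∀ n, dx (φ n) = fun p => θ p.1 * (ε n * ζ' ((p.2 - c) / ε n)) := fun n => by
      ext ⟨t, x⟩
      refine (hasDerivAt_dx (hφ n) t x).unique ((((HasDerivAt.comp x (hd _)
        (hscale n x)).const_mul (ε n ^ 2)).const_mul (θ t)).congr_deriv ?_)
      have := (hε n).ne'
      field_simp
    have hXX : ∀ n, dx (dx (φ n)) = fun p => θ p.1 * ζ'' ((p.2 - c) / ε n) := fun n => by
      ext ⟨t, x⟩
      have h1 := hasDerivAt_dx (contDiff_dx (hφ n)) t x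
      rw [hX] at h1
      rw [hX]
      refine h1.unique ((((HasDerivAt.comp x (hd' _)
        (hscale n x)).const_mul (ε n)).const_mul (θ t)).congr_deriv ?_)
      have := (hε n).ne'
      field_simp
    have hT : ∀ n, dt (φ n) = fun p => deriv θ p.1 * (ε n ^ 2 * ζ ((p.2 - c) / ε n)) := fun n => by
      ext ⟨t, x⟩
      exact (hasDerivAt_dt (hφ n) t x).unique
        (((hθ.differentiable (by simp) t).hasDerivAt).mul_const (ε n ^ 2 * ζ ((x - c) / ε n)))
    have hdir : ∀ n, ζ ((0 - c) / ε n) = 0 := fun n => by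
      rcases hc with rfl | rfl
      · rw [sub_zero, zero_div, z0]
      · refine (hout _ ?_).1
        rw [zero_sub, neg_div, abs_neg]
        exact hε2 n
    have hneu : ∀ n, ζ' ((L - c) / ε n) = 0 := fun n => by
      rcases hc with rfl | rfl
      · rw [sub_zero]
        exact (hout _ (hε2 n)).2.1
      · rw [sub_self, zero_div, z0']
    have htest : ∀ n, ∫ p, (-dt (φ n) (toPlane p) - σ ^ 2 / 2 * dx (dx (φ n)) (toPlane p) +
        b p * dx (φ n) (toPlane p)) ∂M = ∫ x, φ n (0, (x : ℝ)) ∂m₀ := fun n =>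
      h.test hτ (hφ n) (fun t x ht => by simp [φ, hθdef, timeCutoff_eq_zero ht])
        (fun t => by simp only [φ, hdir, mul_zero])
        (fun t => by simp only [hX, hneu, mul_zero])
    have hlimR : Filter.Tendsto (fun n => ∫ x, φ n (0, ((x : Icc (0 : ℝ) L) : ℝ)) ∂m₀)
        Filter.atTop (nhds 0) := by
      refine squeeze_zero_norm (a := fun n => |θ 0| * (ε n ^ 2 * C) * m₀.real univ)
        (fun n => norm_integral_le_of_norm_le_const (ae_of_all _ fun x => ?_)) ?_
      · simp only [φ, norm_mul, Real.norm_eq_abs, abs_pow, sq_abs]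
        gcongr
        exact (hbd _).1
      · have := (((hεlim.pow 2).mul_const C).const_mul |θ 0|).mul_const (m₀.real univ)
        simpa using this
    have hlimL := tendsto_integral_of_dominated_convergence (μ := M)
      (F := fun n p => -dt (φ n) (toPlane p) - σ ^ 2 / 2 * dx (dx (φ n)) (toPlane p) +
        b p * dx (φ n) (toPlane p))
      (f := fun p => if (p.2 : ℝ) = c then -(σ ^ 2 / 2) * θ p.1 else 0)
      (fun p => D' * (L ^ 2 * C) + σ ^ 2 / 2 * (D * C) + |b p| * (D * (L * C)))
      (fun n => ?_) ?_ (fun n => ae_of_all _ fun p => ?_) (ae_of_all _ fun p => ?_)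
    · rw [funext htest] at hlimL
      have hzero := tendsto_nhds_unique hlimL hlimR
      have hset : MeasurableSet {p : Icc (0 : ℝ) T × Icc (0 : ℝ) L | (p.2 : ℝ) = c} :=
        measurableSet_eq_fun (by fun_prop) measurable_const
      have hint : Integrable (fun p : Icc (0 : ℝ) T × Icc (0 : ℝ) L =>
          if (p.2 : ℝ) = c then θ p.1 else 0) M :=
        (integrable_comp_toPlane (M := M) (f := fun p => θ p.1)
          (hθ.continuous.comp continuous_fst)).indicator hset
      have hfac : (fun p : Icc (0 : ℝ) T × Icc (0 : ℝ) L =>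
          if (p.2 : ℝ) = c then -(σ ^ 2 / 2) * θ p.1 else 0) =
          fun p => -(σ ^ 2 / 2) * if (p.2 : ℝ) = c then θ p.1 else 0 := by
        ext p
        split_ifs <;> simp
      rw [hfac, integral_const_mul, mul_eq_zero_iff_left (by
        have := pow_pos hσ 2
        linarith), integral_eq_zero_iff_of_nonneg (fun p => by
          dsimp only
          split_ifs
          exacts [timeCutoff_nonneg, le_rfl]) hint] at hzero
      filter_upwards [hzero] with p hp
      by_cases hpc : (p.2 : ℝ) = c
      · left
        simpa [hpc] using hp
      · exact Or.inr hpc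
    · refine ((integrable_comp_toPlane (f := fun p => -dt (φ n) p - σ ^ 2 / 2 * dx (dx (φ n)) p)
        ?_).add (integrable_drift_mul h.drift_memLp
          (contDiff_dx (hφ n)).continuous)).aestronglyMeasurable
      have h1 := (contDiff_dt (hφ n)).continuous
      have h2 := (contDiff_dx (contDiff_dx (hφ n))).continuous
      fun_prop
    · exact (integrable_const _).add
        ((h.drift_memLp.integrable (by norm_num)).abs.mul_const _)
    · have e1 := hD p.1 p.1.2
      have e2 := hD' p.1 p.1.2
      obtain ⟨b0, b1, b2⟩ := hbd ((p.2 - c) / ε n)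
      have hε0 := (hε n).le
      have hD0 : 0 ≤ D := (norm_nonneg _).trans e1
      have hD0' : 0 ≤ D' := (norm_nonneg _).trans e2
      rw [hXX, hT, hX]
      refine (norm_add_le _ _).trans (add_le_add ((norm_sub_le _ _).trans (add_le_add ?_ ?_)) ?_)
      · rw [norm_neg, norm_mul, norm_mul, Real.norm_of_nonneg (by positivity : 0 ≤ ε n ^ 2)]
        exact mul_le_mul e2 (mul_le_mul (pow_le_pow_left₀ hε0 (hεL n) 2) b0 (norm_nonneg _)
          (by positivity)) (by positivity) hD0'
      · rw [norm_mul, norm_mul, Real.norm_of_nonneg (by positivity : 0 ≤ σ ^ 2 / 2)]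
        exact mul_le_mul_of_nonneg_left (mul_le_mul e1 b2 (norm_nonneg _) hD0) (by positivity)
      · rw [norm_mul, norm_mul, norm_mul, Real.norm_of_nonneg hε0]
        exact mul_le_mul_of_nonneg_left (mul_le_mul e1 (mul_le_mul (hεL n) b1 (norm_nonneg _)
          hL.le) (by positivity) hD0) (norm_nonneg _)
    · by_cases hpc : (p.2 : ℝ) = c
      · have e : (fun n => -dt (φ n) (toPlane p) - σ ^ 2 / 2 * dx (dx (φ n)) (toPlane p) +
            b p * dx (φ n) (toPlane p)) = fun _ => -(σ ^ 2 / 2) * θ p.1 := by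
          ext n
          rw [hXX, hT, hX]
          simp only [toPlane, hpc, sub_self, zero_div, z0, z0', z0'']
          ring
        rw [e, if_pos hpc]
        exact tendsto_const_nhds
      · rw [if_neg hpc]
        have hpos : 0 < |(p.2 : ℝ) - c| := abs_pos.2 (sub_ne_zero.2 hpc)
        refine tendsto_const_nhds.congr' ?_
        filter_upwards [hεlim.eventually (gt_mem_nhds hpos)] with n hn
        have hn1 : 1 < |((p.2 : ℝ) - c) / ε n| := by
          rwa [abs_div, abs_of_pos (hε n), one_lt_div (hε n)]
        obtain ⟨q0, q1, q2⟩ := hout _ hn1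
        rw [hXX, hT, hX]
        simp only [toPlane, q0, q1, q2]
        ring
  have hall : ∀ᵐ p ∂M, ∀ n : ℕ, timeCutoff (T - 1 / ((n : ℝ) + 1)) p.1 = 0 ∨ (p.2 : ℝ) ≠ c :=
    ae_all_iff.2 fun n => main _ (by
      have : 0 < 1 / ((n : ℝ) + 1) := by positivity
      linarith)
  filter_upwards [hall, h.ae_time_lt] with p hp hpT
  obtain ⟨n, hn⟩ := exists_nat_one_div_lt (sub_pos.2 hpT)
  exact (hp n).resolve_left (timeCutoff_pos p.1.2.1 (by linarith)).ne'

end NullSets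

/-! ### Approximation in `L²` by smooth symmetric functions -/

/-- Weighted Stone–Weierstrass in `L²`: the products `w a`, with `a` in a separating algebra of
continuous functions, are dense among the functions of `L²(M)` which vanish where `w` does. This
is the density of the algebra in `L²(w² M)`. -/
lemma exists_integral_sq_sub_mul_le {X : Type*} [TopologicalSpace X] [CompactSpace X]
    [TopologicalSpace.MetrizableSpace X] [MeasurableSpace X] [BorelSpace X] {M : Measure X} [IsFiniteMeasure M]
    {f : X → ℝ} (hf : AEStronglyMeasurable f M) (hf2 : Integrable (fun p => f p ^ 2) M)
    {w : X → ℝ} (hw : Continuous w) (hfw : ∀ᵐ p ∂M, w p = 0 → f p = 0)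
    (A : Subalgebra ℝ C(X, ℝ)) (hA : A.SeparatesPoints) {ε : ℝ} (hε : 0 < ε) :
    ∃ a ∈ A, ∫ p, (f p - w p * a p) ^ 2 ∂M ≤ ε := by
  set N : Measure X := M.withDensity fun p => ENNReal.ofReal (w p ^ 2) with hN
  have hdm : Measurable fun p => ENNReal.ofReal (w p ^ 2) := (hw.pow 2).measurable.ennreal_ofReal
  have hwint : Integrable (fun p => w p ^ 2) M :=
    (hw.pow 2).integrable_of_hasCompactSupport (.of_compactSpace _)
  have hNfin : IsFiniteMeasure N := isFiniteMeasure_withDensity_ofReal hwint.2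
  have htr : ∀ g : X → ℝ, ∫ p, g p ∂N = ∫ p, w p ^ 2 * g p ∂M := fun g => by
    rw [hN, integral_withDensity_eq_integral_toReal_smul hdm
      (ae_of_all _ fun _ => ENNReal.ofReal_lt_top)]
    simp only [ENNReal.toReal_ofReal (sq_nonneg _), smul_eq_mul]
  have hq : ∀ᵐ p ∂M, w p * (f p / w p) = f p := by
    filter_upwards [hfw] with p hp
    by_cases h0 : w p = 0
    · rw [hp h0, h0, zero_mul]
    · field_simp
  have hqL : MemLp (fun p => f p / w p) 2 N := by
    have hmeas : AEStronglyMeasurable (fun p => f p / w p) N :=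
      (hf.aemeasurable.div hw.aemeasurable).aestronglyMeasurable.mono_ac
        (withDensity_absolutelyContinuous M _)
    refine (memLp_two_iff_integrable_sq hmeas).2 ?_
    rw [hN, integrable_withDensity_iff_integrable_smul' hdm
      (ae_of_all _ fun _ => ENNReal.ofReal_lt_top)]
    refine hf2.congr ?_
    filter_upwards [hq] with p hp
    rw [ENNReal.toReal_ofReal (sq_nonneg _), smul_eq_mul, ← mul_pow, hp]
  obtain ⟨g, hg, hgL⟩ := MemLp.exists_boundedContinuous_integral_rpow_sub_le (μ := N) (p := 2)
    two_pos (f := fun p => f p / w p) (by simpa using hqL) (ε := ε / 4) (by positivity)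
  set δ := √(ε / (4 * (N.real univ + 1))) with hδ
  have hδ0 : 0 < δ := by positivity
  have hδ2 : δ ^ 2 * N.real univ ≤ ε / 4 := by
    rw [hδ, Real.sq_sqrt (by positivity), div_mul_eq_mul_div, div_le_div_iff₀ (by positivity)
      (by positivity)]
    nlinarith [measureReal_nonneg (μ := N) (s := univ)]
  have hmem : g.toContinuousMap ∈ A.topologicalClosure := by
    rw [ContinuousMap.subalgebra_topologicalClosure_eq_top_of_separatesPoints A hA]
    trivial
  obtain ⟨a, haA, ha⟩ := Metric.mem_closure_iff.1 hmem δ hδ0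
  refine ⟨a, haA, ?_⟩
  have haL : MemLp a 2 N :=
    a.continuous.memLp_of_hasCompactSupport (.of_compactSpace _)
  have hgL' : MemLp g 2 N := by simpa using hgL
  have e : ∫ p, (f p - w p * a p) ^ 2 ∂M = ∫ p, (f p / w p - a p) ^ 2 ∂N := by
    rw [htr]
    refine integral_congr_ae ?_
    filter_upwards [hq] with p hp
    rw [← mul_pow, mul_sub, hp]
  rw [e]
  have i1 : Integrable (fun p => (f p / w p - g p) ^ 2) N := (hqL.sub hgL').integrable_sq
  have hle : ∫ p, (f p / w p - a p) ^ 2 ∂N ≤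
      ∫ p, (2 * (f p / w p - g p) ^ 2 + 2 * δ ^ 2) ∂N := by
    refine integral_mono (hqL.sub haL).integrable_sq
      ((i1.const_mul 2).add (integrable_const _)) fun p => ?_
    have hga : |g p - a p| ≤ δ := (ContinuousMap.dist_apply_le_dist p).trans ha.le
    have : (g p - a p) ^ 2 ≤ δ ^ 2 := sq_le_sq' (abs_le.1 hga).1 (abs_le.1 hga).2
    dsimp only
    nlinarith [sq_nonneg ((f p / w p - g p) - (g p - a p))]
  refine hle.trans ?_
  rw [integral_add (i1.const_mul 2) (integrable_const _), integral_const_mul, integral_const,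
    smul_eq_mul]
  have hg' : ∫ p, (f p / w p - g p) ^ 2 ∂N ≤ ε / 4 := by
    simpa using hg
  linarith

section Approximation

variable {σ T L : ℝ}

/-- The algebra of the continuous functions on `[0,T] × [0,L]` which extend to smooth functions
on the plane that are even about `x = 0` and about `x = L`. -/
def evenAlgebra (T L : ℝ) : Subalgebra ℝ C(Icc (0 : ℝ) T × Icc (0 : ℝ) L, ℝ) where
  carrier := {a | ∃ f : ℝ × ℝ → ℝ, ContDiff ℝ ∞ f ∧ IsSymmetric 0 1 f ∧ IsSymmetric (2 * L) 1 f ∧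
    ∀ p, a p = f (toPlane p)}
  mul_mem' := by
    rintro a a' ⟨f, hf, h0, hL, ha⟩ ⟨g, hg, k0, kL, ha'⟩
    refine ⟨fun p => f p * g p, hf.mul hg, ?_, ?_, fun p => by simp [ha, ha']⟩
    · simpa using h0.mul k0
    · simpa using hL.mul kL
  add_mem' := by
    rintro a a' ⟨f, hf, h0, hL, ha⟩ ⟨g, hg, k0, kL, ha'⟩
    exact ⟨fun p => f p + g p, hf.add hg, fun t x => by simp only [h0 t x, k0 t x, mul_add],
      fun t x => by simp only [hL t x, kL t x, mul_add], fun p => by simp [ha, ha']⟩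
  algebraMap_mem' r := ⟨fun _ => r, contDiff_const, fun t x => by simp, fun t x => by simp,
    fun p => rfl⟩

lemma evenAlgebra_separatesPoints (hL : 0 < L) : (evenAlgebra T L).SeparatesPoints := by
  have ht : (⟨fun p => (p.1 : ℝ), by fun_prop⟩ : C(Icc (0 : ℝ) T × Icc (0 : ℝ) L, ℝ)) ∈
      evenAlgebra T L :=
    ⟨Prod.fst, contDiff_fst, fun t x => by simp, fun t x => by simp, fun p => rfl⟩
  have hx : (⟨fun p => Real.cos (Real.pi * p.2 / L), by fun_prop⟩ :
      C(Icc (0 : ℝ) T × Icc (0 : ℝ) L, ℝ)) ∈ evenAlgebra T L := by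
    refine ⟨fun p => Real.cos (Real.pi * p.2 / L), by fun_prop, fun t x => ?_, fun t x => ?_,
      fun p => rfl⟩
    · simp only [one_mul]
      rw [← Real.cos_neg]
      congr 1
      ring
    · simp only [one_mul]
      rw [← Real.cos_two_pi_sub]
      congr 1
      field_simp
      ring
  intro p q hpq
  by_cases h1 : p.1 = q.1
  · refine ⟨_, ⟨_, hx, rfl⟩, fun heq => hpq (Prod.ext h1 (Subtype.ext ?_))⟩
    have hmem : ∀ x : Icc (0 : ℝ) L, Real.pi * (x : ℝ) / L ∈ Icc 0 Real.pi := fun x => by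
      have hx0 := x.2.1
      refine ⟨by positivity, ?_⟩
      rw [div_le_iff₀ hL]
      exact mul_le_mul_of_nonneg_left x.2.2 Real.pi_nonneg
    have := Real.injOn_cos (hmem p.2) (hmem q.2) heq
    have hpi := Real.pi_pos
    field_simp at this
    exact this
  · exact ⟨_, ⟨_, ht, rfl⟩, fun heq => h1 (Subtype.ext heq)⟩

/-- A smooth symmetric weight times a cutoff in time: its products with members of `evenAlgebra`
are smooth, periodic in space, and have the symmetries of the weight. -/
lemma isPeriodicSmooth_cutoff_mul {ε δ τ : ℝ} (hε : ε * ε = 1) (hδ : δ * δ = 1) {s f : ℝ × ℝ → ℝ}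
    (hs : ContDiff ℝ ∞ s) (hs0 : IsSymmetric 0 ε s) (hsL : IsSymmetric (2 * L) δ s)
    (hf : ContDiff ℝ ∞ f) (hf0 : IsSymmetric 0 1 f) (hfL : IsSymmetric (2 * L) 1 f) :
    let ψ : ℝ × ℝ → ℝ := fun p => timeCutoff τ p.1 * s p * f p
    IsPeriodicSmooth (4 * L) ψ ∧ IsSymmetric 0 ε ψ ∧ IsSymmetric (2 * L) δ ψ ∧
      ∀ t x, τ ≤ t → ψ (t, x) = 0 := by
  intro ψ
  have h0 : IsSymmetric 0 ε ψ := fun t x => by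
    simp only [ψ, hs0 t x, hf0 t x]
    ring
  have hL : IsSymmetric (2 * L) δ ψ := fun t x => by
    simp only [ψ, hsL t x, hfL t x]
    ring
  have hv : ∀ t x, τ ≤ t → ψ (t, x) = 0 := fun t x ht => by
    simp only [ψ, timeCutoff_eq_zero ht, zero_mul]
  refine ⟨⟨((contDiff_timeCutoff.comp contDiff_fst).mul hs).mul hf,
    periodic_of_isSymmetric h0 hL hε hδ, max 1 |τ|, fun p hp => ?_⟩, h0, hL, hv⟩
  obtain ⟨h1, h2⟩ := max_lt_iff.1 hp
  rcases lt_abs.1 h1 with h | h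
  · refine hv _ _ ((le_abs_self τ).trans ?_)
    rw [abs_of_pos (by linarith : 0 < p.1)] at h2
    exact h2.le
  · simp only [ψ, timeCutoff_eq_zero_of_le (by linarith : p.1 ≤ -1), zero_mul]

lemma sin_isSymmetric (hL : 0 < L) :
    IsSymmetric 0 (-1) (fun p => Real.sin (Real.pi * p.2 / L)) ∧
      IsSymmetric (2 * L) (-1) (fun p => Real.sin (Real.pi * p.2 / L)) := by
  constructor <;> intro t x <;> simp only [neg_one_mul]
  · rw [← Real.sin_neg]
    congr 1
    ring
  · rw [← Real.sin_two_pi_sub]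
    congr 1
    field_simp

lemma sin_half_isSymmetric (hL : 0 < L) :
    IsSymmetric 0 (-1) (fun p => Real.sin (Real.pi * p.2 / (2 * L))) ∧
      IsSymmetric (2 * L) 1 (fun p => Real.sin (Real.pi * p.2 / (2 * L))) := by
  constructor <;> intro t x <;> simp only [neg_one_mul, one_mul]
  · rw [← Real.sin_neg]
    congr 1
    ring
  · rw [← Real.sin_pi_sub]
    congr 1
    field_simp
    ring

variable {b : Icc (0 : ℝ) T × Icc (0 : ℝ) L → ℝ} {m₀ : Measure (Icc (0 : ℝ) L)}
  {M₁ M₂ : Measure (Icc (0 : ℝ) T × Icc (0 : ℝ) L)}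

/-- The drift is approximated in `L²` of both solutions by smooth drifts which are odd about
`x = 0` and about `x = L`. Such drifts vanish on the lateral boundary, a null set. -/
lemma exists_drift_approximation (hσ : 0 < σ) (hL : 0 < L) [IsFiniteMeasure m₀]
    (h₁ : IsMeasureValuedWeakSolution σ T L b m₀ M₁)
    (h₂ : IsMeasureValuedWeakSolution σ T L b m₀ M₂) {η : ℝ} (hη : 0 < η) :
    ∃ β : ℝ × ℝ → ℝ, IsPeriodicSmooth (4 * L) β ∧ IsSymmetric 0 (-1) β ∧
      IsSymmetric (2 * L) (-1) β ∧ ∫ p, (b p - β (toPlane p)) ^ 2 ∂M₁ ≤ η ∧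
      ∫ p, (b p - β (toPlane p)) ^ 2 ∂M₂ ≤ η := by
  have := h₁.isFiniteMeasure
  have := h₂.isFiniteMeasure
  have hpi := Real.pi_pos
  have hne : ∀ᵐ p ∂(M₁ + M₂), (p.2 : ℝ) ≠ 0 ∧ (p.2 : ℝ) ≠ L :=
    ae_add_measure_iff.2
      ⟨(h₁.ae_ne_of_boundary hσ hL (Or.inl rfl)).and (h₁.ae_ne_of_boundary hσ hL (Or.inr rfl)),
        (h₂.ae_ne_of_boundary hσ hL (Or.inl rfl)).and (h₂.ae_ne_of_boundary hσ hL (Or.inr rfl))⟩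
  obtain ⟨a, ⟨f, hf, hf0, hfL, haf⟩, hle⟩ := exists_integral_sq_sub_mul_le (M := M₁ + M₂)
    (h₁.drift_memLp.1.add_measure h₂.drift_memLp.1)
    (h₁.drift_memLp.integrable_sq.add_measure h₂.drift_memLp.integrable_sq)
    (w := fun p => Real.sin (Real.pi * p.2 / L)) (by fun_prop)
    (by
      filter_upwards [hne] with p hp h0
      have hp0 : 0 < (p.2 : ℝ) := lt_of_le_of_ne p.2.2.1 hp.1.symm
      refine absurd h0 (Real.sin_pos_of_pos_of_lt_pi (by positivity) ?_).ne'
      rw [div_lt_iff₀ hL]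
      exact mul_lt_mul_of_pos_left (lt_of_le_of_ne p.2.2.2 hp.2) hpi)
    (evenAlgebra T L) (evenAlgebra_separatesPoints hL) hη
  obtain ⟨s0, sL⟩ := sin_isSymmetric hL
  obtain ⟨c1, c2, c3, -⟩ := isPeriodicSmooth_cutoff_mul (τ := T + 1) (by norm_num) (by norm_num)
    (by fun_prop) s0 sL hf hf0 hfL
  refine ⟨_, c1, c2, c3, ?_⟩
  have e : ∀ p : Icc (0 : ℝ) T × Icc (0 : ℝ) L, timeCutoff (T + 1) (toPlane p).1 *
      Real.sin (Real.pi * (toPlane p).2 / L) * f (toPlane p) =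
        Real.sin (Real.pi * p.2 / L) * a p := fun p => by
    rw [timeCutoff_eq_one (t := (toPlane p).1) p.1.2.1 (by linarith [p.1.2.2, show
      (toPlane p).1 = p.1 from rfl]), one_mul, haf]
    rfl
  simp only [e]
  have hsin : Continuous fun p : Icc (0 : ℝ) T × Icc (0 : ℝ) L =>
      Real.sin (Real.pi * p.2 / L) * a p := by fun_prop
  have hint : ∀ {M : Measure (Icc (0 : ℝ) T × Icc (0 : ℝ) L)} [IsFiniteMeasure M], MemLp b 2 M →
      Integrable (fun p => (b p - Real.sin (Real.pi * p.2 / L) * a p) ^ 2) M := fun {M} _ hb =>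
    (hb.sub (hsin.memLp_of_hasCompactSupport (.of_compactSpace _))).integrable_sq
  have i1 := hint h₁.drift_memLp
  have i2 := hint h₂.drift_memLp
  rw [integral_add_measure i1 i2] at hle
  have hnn : ∀ M : Measure (Icc (0 : ℝ) T × Icc (0 : ℝ) L),
      0 ≤ ∫ p, (b p - Real.sin (Real.pi * p.2 / L) * a p) ^ 2 ∂M := fun M =>
    integral_nonneg fun p => sq_nonneg _
  have n1 := hnn M₁
  have n2 := hnn M₂
  exact ⟨by linarith, by linarith⟩

/-- Two weak solutions agree on the measurable subsets of `[0, τ) × (0, L]` for `τ < T`. -/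
lemma measure_inter_eq (hσ : 0 < σ) (hT : 0 < T) (hL : 0 < L) [IsFiniteMeasure m₀]
    (h₁ : IsMeasureValuedWeakSolution σ T L b m₀ M₁)
    (h₂ : IsMeasureValuedWeakSolution σ T L b m₀ M₂) {τ : ℝ} (hτ : τ < T)
    {A : Set (Icc (0 : ℝ) T × Icc (0 : ℝ) L)} (hA : MeasurableSet A)
    (hAτ : ∀ p ∈ A, (p.1 : ℝ) < τ ∧ (p.2 : ℝ) ≠ 0) : M₁ A = M₂ A := by
  have := h₁.isFiniteMeasure
  have := h₂.isFiniteMeasure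
  set f : Icc (0 : ℝ) T × Icc (0 : ℝ) L → ℝ := A.indicator 1 with hf
  have hfL : ∀ {M : Measure (Icc (0 : ℝ) T × Icc (0 : ℝ) L)} [IsFiniteMeasure M],
      MemLp f 2 M := fun {M} _ => (memLp_const 1).indicator hA
  have key : ∀ η > 0, |∫ p, f p ∂M₁ - ∫ p, f p ∂M₂| ≤
      η * (M₁.real univ + M₂.real univ + 1) / 2 := by
    intro η hη
    obtain ⟨a, ⟨g, hg, hg0, hgL, hag⟩, hle⟩ := exists_integral_sq_sub_mul_le (M := M₁ + M₂)
      (hfL (M := M₁ + M₂)).1 (hfL (M := M₁ + M₂)).integrable_sq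
      (w := fun p => timeCutoff τ (toPlane p).1 * Real.sin (Real.pi * (toPlane p).2 / (2 * L)))
      (continuous_comp_toPlane (f := fun q => timeCutoff τ q.1 *
        Real.sin (Real.pi * q.2 / (2 * L)))
        ((contDiff_timeCutoff.continuous.comp continuous_fst).mul (by fun_prop)))
      (ae_of_all _ fun p h0 => by
        refine indicator_of_notMem (fun hp => ?_) _
        obtain ⟨hp1, hp2⟩ := hAτ p hp
        have hp0 : 0 < (p.2 : ℝ) := lt_of_le_of_ne p.2.2.1 hp2.symm
        have hpi := Real.pi_pos
        refine (mul_pos (timeCutoff_pos p.1.2.1 hp1)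
          (Real.sin_pos_of_pos_of_lt_pi (by positivity) ?_)).ne' h0
        rw [div_lt_iff₀ (by positivity)]
        exact mul_lt_mul_of_pos_left (p.2.2.2.trans_lt (by linarith)) hpi)
      (evenAlgebra T L) (evenAlgebra_separatesPoints hL) (ε := η ^ 2) (by positivity)
    obtain ⟨s0, sL⟩ := sin_half_isSymmetric hL
    obtain ⟨c1, c2, c3, c4⟩ := isPeriodicSmooth_cutoff_mul (τ := τ) (by norm_num) (by norm_num)
      (by fun_prop) s0 sL hg hg0 hgL
    set ψ : ℝ × ℝ → ℝ := fun p => timeCutoff τ p.1 * Real.sin (Real.pi * p.2 / (2 * L)) * g p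
    have heq := integral_eq_of_drift_approximation hσ hT hL h₁ h₂
      (fun η hη => exists_drift_approximation hσ hL h₁ h₂ hη) hτ c1 c2 c3 c4
    simp only [hag] at hle
    change ∫ p, (f p - ψ (toPlane p)) ^ 2 ∂(M₁ + M₂) ≤ η ^ 2 at hle
    have hψc : Continuous ψ := c1.smooth.continuous
    have isq : ∀ {M : Measure (Icc (0 : ℝ) T × Icc (0 : ℝ) L)} [IsFiniteMeasure M],
        Integrable (fun p => (f p - ψ (toPlane p)) ^ 2) M := fun {M} _ =>
      (hfL.sub (memLp_comp_toPlane hψc)).integrable_sq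
    rw [integral_add_measure isq isq] at hle
    -- The inequality between the `L¹` and `L²` norms, in the form `|u| ≤ η / 2 + u² / (2 η)`.
    have est : ∀ {M : Measure (Icc (0 : ℝ) T × Icc (0 : ℝ) L)} [IsFiniteMeasure M],
        |∫ p, f p ∂M - ∫ p, ψ (toPlane p) ∂M| ≤
          η / 2 * M.real univ + 1 / (2 * η) * ∫ p, (f p - ψ (toPlane p)) ^ 2 ∂M := by
      intro M _
      rw [← integral_sub (hfL.integrable (by norm_num)) (integrable_comp_toPlane hψc),
        ← Real.norm_eq_abs]
      refine (norm_integral_le_of_norm_le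
        (g := fun p => η / 2 + 1 / (2 * η) * (f p - ψ (toPlane p)) ^ 2)
        ((integrable_const _).add (isq.const_mul _)) (ae_of_all _ fun p => ?_)).trans ?_
      · set u := f p - ψ (toPlane p)
        rw [Real.norm_eq_abs, ← sq_abs u]
        have e : η / 2 + 1 / (2 * η) * |u| ^ 2 - |u| = 1 / (2 * η) * (|u| - η) ^ 2 := by
          field_simp
          ring
        refine sub_nonneg.1 ?_
        rw [e]
        positivity
      · rw [integral_add (integrable_const _) (isq.const_mul _), integral_const_mul,
          integral_const, smul_eq_mul, mul_comm (η / 2)]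
    have e1 := est (M := M₁)
    have e2 := est (M := M₂)
    rw [← heq, abs_sub_comm] at e2
    have tri := abs_sub_le (∫ p, f p ∂M₁) (∫ p, ψ (toPlane p) ∂M₁) (∫ p, f p ∂M₂)
    have hsum : 1 / (2 * η) * ∫ p, (f p - ψ (toPlane p)) ^ 2 ∂M₁ +
        1 / (2 * η) * ∫ p, (f p - ψ (toPlane p)) ^ 2 ∂M₂ ≤ η / 2 := by
      rw [← mul_add]
      calc _ ≤ 1 / (2 * η) * η ^ 2 := by gcongr
        _ = η / 2 := by field_simp
    linarith
  have hKpos : 0 < M₁.real univ + M₂.real univ + 1 := by positivity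
  have hint : ∫ p, f p ∂M₁ = ∫ p, f p ∂M₂ := by
    refine eq_of_abs_sub_nonpos (le_of_forall_pos_le_add fun δ hδ => ?_)
    refine (key (δ / (M₁.real univ + M₂.real univ + 1)) (by positivity)).trans ?_
    rw [div_mul_cancel₀ _ hKpos.ne']
    linarith
  rw [hf, integral_indicator_one hA, integral_indicator_one hA] at hint
  exact (measureReal_eq_measureReal_iff).1 hint

end Approximation

end FokkerPlanck

theorem mainTheorem4 (σ T L : ℝ) (hσ : 0 < σ) (hT : 0 < T) (hL : 0 < L)
    (b : Icc (0 : ℝ) T × Icc (0 : ℝ) L → ℝ)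
    (m₀ : Measure (Icc (0 : ℝ) L)) [IsProbabilityMeasure m₀]
    (M₁ M₂ : Measure (Icc (0 : ℝ) T × Icc (0 : ℝ) L))
    (h₁ : FokkerPlanck.IsMeasureValuedWeakSolution σ T L b m₀ M₁)
    (h₂ : FokkerPlanck.IsMeasureValuedWeakSolution σ T L b m₀ M₂) :
    M₁ = M₂ := by
  refine Measure.ext fun A hA => ?_
  let B : ℕ → Set (Icc (0 : ℝ) T × Icc (0 : ℝ) L) := fun n =>
    {p | (p.1 : ℝ) < T - 1 / ((n : ℝ) + 1)} ∩ {p | (p.2 : ℝ) ≠ 0}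
  have hB : ∀ n, MeasurableSet (B n) := fun n =>
    (measurableSet_lt (by fun_prop) measurable_const).inter
      (measurableSet_eq_fun (by fun_prop) measurable_const).compl
  have hmono : Monotone fun n => A ∩ B n := fun n k hnk => by
    refine inter_subset_inter_right _ (inter_subset_inter_left _ fun p hp => ?_)
    exact lt_of_lt_of_le (b := T - 1 / ((n : ℝ) + 1)) hp
      (sub_le_sub_left (Nat.one_div_le_one_div hnk) T)
  have hlim : ∀ M, FokkerPlanck.IsMeasureValuedWeakSolution σ T L b m₀ M →
      Filter.Tendsto (fun n => M (A ∩ B n)) Filter.atTop (nhds (M A)) := by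
    intro M h
    have hae : M (⋃ n, A ∩ B n) = M A := by
      refine measure_congr ?_
      filter_upwards [h.ae_time_lt, h.ae_ne_of_boundary hσ hL (Or.inl rfl)] with p hpT hp0
      refine propext ⟨fun hp => (mem_iUnion.1 hp).elim fun n hn => hn.1, fun hp => ?_⟩
      obtain ⟨n, hn⟩ := exists_nat_one_div_lt (sub_pos.2 hpT)
      exact mem_iUnion.2 ⟨n, hp, lt_sub_comm.1 hn, hp0⟩
    rw [← hae]
    exact tendsto_measure_iUnion_atTop hmono
  refine tendsto_nhds_unique (hlim M₁ h₁) ((hlim M₂ h₂).congr fun n => ?_)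
  refine (FokkerPlanck.measure_inter_eq hσ hT hL h₁ h₂ (τ := T - 1 / ((n : ℝ) + 1)) ?_
    (hA.inter (hB n)) fun p hp => hp.2).symm
  have : 0 < 1 / ((n : ℝ) + 1) := by positivity
  linarith
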